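/- Let $\mathbb T=([0,+\infty],\min,+)$ be the tropical semiring (its zero is $+\infty$, its one is the number $0$). Let $n\ge 1$ and let $s=\sum_\mu s_\mu x^\mu\neq 0$ be a polynomial in $n$ variables over $\mathbb T$, with support $\mathrm{supp}(s)=\{\mu\in\mathbb N^n : s_\mu\neq+\infty\}$, and let $|s|:=\#\mathrm{supp}(s)\ge 1$. Let $NP(s)\subseteq\mathbb R^n$ be the convex hull of $\mathrm{supp}(s)$, let $\mathrm{Vert}(NP(s))\subseteq\mathbb N^n$ be its set of vertices, let $V_{\min}(s)$ be the set of the minimal elements of $\mathrm{Vert}(NP(s))$ for the pointwise order of $\mathbb N^n$, let $NP_{\min}(s)$ be the convex hull of $V_{\min}(s)$, and let $s_{\min}:=\sum_{\mu\in V_{\min}(s)}x^\mu$ (all non-zero coefficients are the one of $\mathbb T$). Then $\mathrm{supp}(s_{\min})=\mathrm{Vert}(NP_{\min}(s))$, and $s_{\min}$ can be computed by a randomised algorithm in expected time $O(n|s|^{\max\{2,n\}})$. That is, there are a single program $P$ of the randomised real RAM (integer and real memory cells with indirect addressing; memory accesses, arithmetic operations, comparisons and the drawing of a uniform random integer in $\{0,\dots,b\}$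 each take one unit of time) and a constant $C$ such that, for all $n\geq 1$ and all $s\neq 0$ as above, when $P$ is started on any memory that holds $n$, $|s|$ and the list of the terms of $s$ (coefficient and $n$ exponents), in any order and without repetition, $P$ halts with probability $1$ with a memory that holds $s_{\min}$ in the same format, and its expected running time is at most $C\,n\,|s|^{\max\{2,n\}}$. -/

import Mathlib

open scoped ENNReal

noncomputable section

/-! ### Tropical polynomials and their (minimal) Newton polytopes -/

namespace TropPoly

/-- The tropical semiring `([0,+∞], min, +)`: its zero is `+∞` and its one is the number `0`. -/
abbrev 𝕋 : Type := Tropical ℝ≥0∞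

/-- A monomial, that is an exponent vector in `ℕⁿ`, as a point of `ℝⁿ`. -/
def toPoint {n : ℕ} (μ : Fin n →₀ ℕ) : Fin n → ℝ := fun j => (μ j : ℝ)

/-- The Newton polytope: the convex hull of the support. -/
def NP {n : ℕ} (s : MvPolynomial (Fin n) 𝕋) : Set (Fin n → ℝ) :=
  convexHull ℝ (toPoint '' (s.support : Set (Fin n →₀ ℕ)))

/-- The monomials that are vertices (extreme points) of the Newton polytope. -/
def vertNP {n : ℕ} (s : MvPolynomial (Fin n) 𝕋) : Set (Fin n →₀ ℕ) :=
  {μ | toPoint μ ∈ Set.extremePoints ℝ (NP s)}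

/-- The minimal elements of the vertices of `NP s`, for the pointwise order of `ℕⁿ`. -/
def vertNPmin {n : ℕ} (s : MvPolynomial (Fin n) 𝕋) : Set (Fin n →₀ ℕ) :=
  {μ | Minimal (fun ν => ν ∈ vertNP s) μ}

/-- The minimal Newton polytope. -/
def NPmin {n : ℕ} (s : MvPolynomial (Fin n) 𝕋) : Set (Fin n → ℝ) :=
  convexHull ℝ (toPoint '' vertNPmin s)

open Classical in
/-- The all-one polynomial whose monomials are those of `vertNPmin s` (a subset of the support). -/
def sMin {n : ℕ} (s : MvPolynomial (Fin n) 𝕋) : MvPolynomial (Fin n) 𝕋 :=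
  ∑ μ ∈ s.support.filter (fun μ => μ ∈ vertNPmin s), MvPolynomial.monomial μ 1

end TropPoly

/-! ### Randomised real RAM

The unit-cost model of computational geometry: a memory of integer cells (used for counters and
addresses) and a memory of real cells, both with indirect addressing; one unit of time for each
memory access, arithmetic operation, comparison, and random draw. Programs are finite and have
structured control flow. -/

namespace RealRAM

/-- The memory: cell `a` of the integer part holds `int a`, cell `a` of the real part `real a`. -/
structure Mem where
  int : ℕ → ℕ
  real : ℕ → ℝ

/-- Integer expressions. `load a` is the content of the integer cell whose address is `a`. -/
inductive IExpr where
  | const (k : ℕ)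
  | load (a : IExpr)
  | add (a b : IExpr)
  | sub (a b : IExpr)
  | mul (a b : IExpr)

/-- Real expressions. `load a` is the content of the real cell whose address is `a`. -/
inductive RExpr where
  | const (k : ℤ)
  | load (a : IExpr)
  | add (a b : RExpr)
  | sub (a b : RExpr)
  | mul (a b : RExpr)
  | div (a b : RExpr)

/-- Tests. -/
inductive Test where
  | ile (a b : IExpr)
  | rle (a b : RExpr)
  | neg (p : Test)
  | conj (p q : Test)

/-- Programs. -/
inductive Prog where
  | skip
  | istore (addr val : IExpr)
  | rstore (addr : IExpr) (val : RExpr)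
  | rand (addr bound : IExpr)
  | seq (p q : Prog)
  | ite (b : Test) (p q : Prog)
  | loop (b : Test) (p : Prog)

/-- Value of an integer expression; subtraction is truncated at `0`. -/
def IExpr.eval (M : Mem) : IExpr → ℕ
  | .const k => k
  | .load a => M.int (a.eval M)
  | .add a b => a.eval M + b.eval M
  | .sub a b => a.eval M - b.eval M
  | .mul a b => a.eval M * b.eval M

/-- Value of a real expression; a quotient by `0` is `0`. -/
def RExpr.eval (M : Mem) : RExpr → ℝ
  | .const k => (k : ℝ)
  | .load a => M.real (a.eval M)
  | .add a b => a.eval M + b.eval M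
  | .sub a b => a.eval M - b.eval M
  | .mul a b => a.eval M * b.eval M
  | .div a b => a.eval M / b.eval M

/-- Truth of a test. -/
def Test.Holds (M : Mem) : Test → Prop
  | .ile a b => a.eval M ≤ b.eval M
  | .rle a b => a.eval M ≤ b.eval M
  | .neg p => ¬ p.Holds M
  | .conj p q => p.Holds M ∧ q.Holds M

/-- Time to evaluate an integer expression: the number of its nodes. -/
def IExpr.cost : IExpr → ℕ
  | .const _ => 1
  | .load a => a.cost + 1
  | .add a b => a.cost + b.cost + 1
  | .sub a b => a.cost + b.cost + 1
  | .mul a b => a.cost + b.cost + 1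

/-- Time to evaluate a real expression: the number of its nodes. -/
def RExpr.cost : RExpr → ℕ
  | .const _ => 1
  | .load a => a.cost + 1
  | .add a b => a.cost + b.cost + 1
  | .sub a b => a.cost + b.cost + 1
  | .mul a b => a.cost + b.cost + 1
  | .div a b => a.cost + b.cost + 1

/-- Time to evaluate a test: the number of its nodes. -/
def Test.cost : Test → ℕ
  | .ile a b => a.cost + b.cost + 1
  | .rle a b => a.cost + b.cost + 1
  | .neg p => p.cost + 1
  | .conj p q => p.cost + q.cost + 1

/-- Write `v` into the integer cell `a`. -/
def Mem.setInt (M : Mem) (a v : ℕ) : Mem := { M with int := Function.update M.int a v }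

/-- Write `v` into the real cell `a`. -/
def Mem.setReal (M : Mem) (a : ℕ) (v : ℝ) : Mem := { M with real := Function.update M.real a v }

/-- A configuration: the stack of programs that remain to be executed, and the memory.
The machine has halted when the stack is empty. -/
abbrev Config : Type := List Prog × Mem

open Classical in
/-- One transition. The instruction `rand addr bound` draws an integer uniformly from
`{0, …, bound}`, independently of everything before, and writes it into an integer cell. -/
def step : Config → PMF Config
  | ([], M) => PMF.pure ([], M)
  | (.skip :: K, M) => PMF.pure (K, M)
  | (.istore a e :: K, M) => PMF.pure (K, M.setInt (a.eval M) (e.eval M))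
  | (.rstore a e :: K, M) => PMF.pure (K, M.setReal (a.eval M) (e.eval M))
  | (.rand a b :: K, M) =>
      (PMF.uniformOfFintype (Fin (b.eval M + 1))).map fun v => (K, M.setInt (a.eval M) v)
  | (.seq p q :: K, M) => PMF.pure (p :: q :: K, M)
  | (.ite b p q :: K, M) => PMF.pure (if b.Holds M then (p :: K, M) else (q :: K, M))
  | (.loop b p :: K, M) => PMF.pure (if b.Holds M then (p :: .loop b p :: K, M) else (K, M))

/-- Time taken by the next transition: `1` plus the time to evaluate its expressions. -/
def stepCost : Config → ℕ
  | ([], _) => 0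
  | (.skip :: _, _) => 1
  | (.istore a e :: _, _) => a.cost + e.cost + 1
  | (.rstore a e :: _, _) => a.cost + e.cost + 1
  | (.rand a b :: _, _) => a.cost + b.cost + 1
  | (.seq _ _ :: _, _) => 1
  | (.ite b _ _ :: _, _) => b.cost + 1
  | (.loop b _ :: _, _) => b.cost + 1

/-- The law of the configuration reached after `t` transitions. -/
def run : ℕ → Config → PMF Config
  | 0, c => PMF.pure c
  | t + 1, c => (step c).bind (run t)

/-- The expected running time of the program `P` on the initial memory `M`: the sum, over all
`t`, of the expected time of the transition number `t`. -/
def expectedTime (P : Prog) (M : Mem) : ℝ≥0∞ :=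
  ∑' t : ℕ, ∑' c : Config, run t ([P], M) c * (stepCost c : ℝ≥0∞)

/-- The probability that `P`, started on the memory `M`, halts with a memory in `Post`. -/
def haltProb (P : Prog) (M : Mem) (Post : Set Mem) : ℝ≥0∞ :=
  ⨆ t : ℕ, (run t ([P], M)).toOuterMeasure {c | c.1 = [] ∧ c.2 ∈ Post}

/-- The memory `M` holds the polynomial `p`, given by the list of its terms in some order, without
repetition: integer cell `0` holds the number of variables `n`, integer cell `1` the number of
terms, and the real cells from `i * (n + 1)` on hold the coefficient and then the `n` exponents of
the `i`-th term. All other cells are arbitrary. (Coefficients on the support are finite.) -/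
def Stores {n : ℕ} (M : Mem) (p : MvPolynomial (Fin n) TropPoly.𝕋) : Prop :=
  M.int 0 = n ∧ M.int 1 = p.support.card ∧
  ∃ e : Fin p.support.card ≃ p.support, ∀ i : Fin p.support.card,
    M.real (i * (n + 1)) = (Tropical.untrop (p.coeff (e i))).toReal ∧
    ∀ j : Fin n, M.real (i * (n + 1) + 1 + j) = ((e i : Fin n →₀ ℕ) j : ℝ)

end RealRAM

end

/-! A monomial `μ` is a vertex of the Newton polytope exactly when some linear form is strictly
smaller at `μ` than at every other monomial, that is, when the homogeneous strict system `0 < w ⬝ᵥ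
(ν - μ)`, `ν ≠ μ`, is solvable (`mem_vertNP_iff`). A vertex of `NP s` that lies in the smaller
polytope `NPmin s` is still extreme there, which gives the statement on the support
(`image_support_sMin`).

The system is solved incrementally. Let `w` solve the first `i` constraints. If it also satisfies `a
i`, go on. Otherwise, if the first `i + 1` constraints are solvable at all, the first `i` have a
solution orthogonal to `a i` (`Feas.descend`); so they are projected along `a i` and solved in one
dimension less. A solution found there, tilted slightly towards `a i`, solves the first `i + 1`
constraints (`exists_lift`). In a plane it is enough to search a line (`Feas.exists_line`), so one
unknown remains and the solutions form an interval (`Exec.interval`). The induction on the dimension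
is `solve`.

Counted in vector operations, `m` constraints in dimension `d > 2` cost at most the sum over `j < m`
of the cost of `j` constraints in dimension `d - 1` plus `O(j)`; in dimension two they cost `O(m)`.
Each summation gains a factor two (`two_mul_sum_pow_le`), so the bound `O((m + 1) ^ (d - 1))` has a
constant independent of `d` (`solveTime_le`). With `N` terms there are `N` systems of `N - 1`
constraints in dimension `max 2 n` (for `n = 1` the points are padded by a zero coordinate), and a
vector operation takes time `O(n)`: this is `O(n * N ^ max 2 n)`. The pairwise comparisons for
minimality and the output cost no more.

The program draws no random numbers: the bound holds in the worst case, and expected time and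
halting probability are read off from a deterministic run (`Runs.expectedTime_eq`,
`Runs.haltProb_eq`). Programs are verified in a timed Hoare logic `Exec` over a structured view
`Rep` of the memory. -/

namespace RealRAM

/-! ### Big-step semantics of the deterministic instructions -/

/-- `Runs P M t M'`: the program `P`, started on `M`, halts on `M'` after time `t` without
drawing random numbers. -/
inductive Runs : Prog → Mem → ℕ → Mem → Prop
  | skip (M : Mem) : Runs .skip M 1 M
  | istore (a e : IExpr) (M : Mem) :
      Runs (.istore a e) M (a.cost + e.cost + 1) (M.setInt (a.eval M) (e.eval M))
  | rstore (a : IExpr) (e : RExpr) (M : Mem) :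
      Runs (.rstore a e) M (a.cost + e.cost + 1) (M.setReal (a.eval M) (e.eval M))
  | seq {p q : Prog} {M M' M'' : Mem} {t t' : ℕ} :
      Runs p M t M' → Runs q M' t' M'' → Runs (.seq p q) M (t + t' + 1) M''
  | ite_true {b : Test} {p q : Prog} {M M' : Mem} {t : ℕ} :
      b.Holds M → Runs p M t M' → Runs (.ite b p q) M (t + b.cost + 1) M'
  | ite_false {b : Test} {p q : Prog} {M M' : Mem} {t : ℕ} :
      ¬ b.Holds M → Runs q M t M' → Runs (.ite b p q) M (t + b.cost + 1) M'
  | loop_true {b : Test} {p : Prog} {M M' M'' : Mem} {t t' : ℕ} :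
      b.Holds M → Runs p M t M' → Runs (.loop b p) M' t' M'' →
        Runs (.loop b p) M (t + t' + b.cost + 1) M''
  | loop_false {b : Test} {p : Prog} {M : Mem} :
      ¬ b.Holds M → Runs (.loop b p) M (b.cost + 1) M

/-- The expected time spent from a configuration on. -/
noncomputable def timeFrom (c₀ : Config) : ℝ≥0∞ :=
  ∑' t : ℕ, ∑' c : Config, run t c₀ c * (stepCost c : ℝ≥0∞)

theorem tsum_pure_mul (c₀ : Config) (f : Config → ℝ≥0∞) :
    ∑' c : Config, (PMF.pure c₀) c * f c = f c₀ := by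
  rw [tsum_eq_single c₀]
  · simp
  · intro c hc; simp [hc]

theorem run_succ_of_step {c₀ c₁ : Config} (h : step c₀ = PMF.pure c₁) (t : ℕ) :
    run (t + 1) c₀ = run t c₁ := by
  simp [run, h]

theorem timeFrom_of_step {c₀ c₁ : Config} (h : step c₀ = PMF.pure c₁) :
    timeFrom c₀ = stepCost c₀ + timeFrom c₁ := by
  unfold timeFrom
  rw [tsum_eq_zero_add' ENNReal.summable]
  congr 1
  · exact tsum_pure_mul c₀ _
  · simp only [run_succ_of_step h]

theorem run_nil (t : ℕ) (M : Mem) : run t ([], M) = PMF.pure ([], M) := by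
  induction t with
  | zero => rfl
  | succ t ih => rw [run_succ_of_step (c₁ := ([], M)) (by simp [step]), ih]

theorem timeFrom_nil (M : Mem) : timeFrom ([], M) = 0 := by
  unfold timeFrom
  simp only [run_nil, tsum_pure_mul, stepCost]
  simp

/-- `T` deterministic transitions taking time `t` lead from `c₀` to `c₁`. -/
def Reaches (c₀ : Config) (t : ℕ) (c₁ : Config) : Prop :=
  (∃ T, ∀ r, run (r + T) c₀ = run r c₁) ∧ timeFrom c₀ = t + timeFrom c₁

theorem Reaches.trans {a b c : Config} {s t : ℕ} (h₁ : Reaches a s b) (h₂ : Reaches b t c) :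
    Reaches a (s + t) c := by
  obtain ⟨⟨T₁, e₁⟩, f₁⟩ := h₁
  obtain ⟨⟨T₂, e₂⟩, f₂⟩ := h₂
  refine ⟨⟨T₂ + T₁, fun r => ?_⟩, ?_⟩
  · rw [← add_assoc, e₁, e₂]
  · rw [f₁, f₂]; push_cast; ring

theorem Reaches.of_step {c₀ c₁ : Config} (h : step c₀ = PMF.pure c₁) :
    Reaches c₀ (stepCost c₀) c₁ :=
  ⟨⟨1, fun r => run_succ_of_step h r⟩, timeFrom_of_step h⟩

/-- The stack `K` is arbitrary because the parts of a `seq` or a `loop` are executed with other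
programs waiting below them. -/
theorem Runs.reaches {P : Prog} {M M' : Mem} {t : ℕ} (h : Runs P M t M') (K : List Prog) :
    Reaches (P :: K, M) t (K, M') := by
  induction h generalizing K with
  | skip M => exact Reaches.of_step (by simp [step])
  | istore a e M => exact Reaches.of_step (by simp [step])
  | rstore a e M => exact Reaches.of_step (by simp [step])
  | @seq p q M M' M'' t t' _ _ ih₁ ih₂ =>
    have := ((Reaches.of_step (c₀ := (.seq p q :: K, M)) (by simp only [step])).trans
      (ih₁ (q :: K))).trans (ih₂ K)
    convert this using 1
    simp only [stepCost]; ring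
  | @ite_true b p q M M' t hb _ ih =>
    have := (Reaches.of_step (c₀ := (.ite b p q :: K, M)) (c₁ := (p :: K, M))
      (by simp [step, hb])).trans (ih K)
    convert this using 1
    simp only [stepCost]; ring
  | @ite_false b p q M M' t hb _ ih =>
    have := (Reaches.of_step (c₀ := (.ite b p q :: K, M)) (c₁ := (q :: K, M))
      (by simp [step, hb])).trans (ih K)
    convert this using 1
    simp only [stepCost]; ring
  | @loop_true b p M M' M'' t t' hb _ _ ih₁ ih₂ =>
    have := ((Reaches.of_step (c₀ := (.loop b p :: K, M)) (c₁ := (p :: .loop b p :: K, M))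
      (by simp [step, hb])).trans (ih₁ (.loop b p :: K))).trans (ih₂ K)
    convert this using 1
    simp only [stepCost]; ring
  | @loop_false b p M hb =>
    have := (Reaches.of_step (c₀ := (.loop b p :: K, M)) (c₁ := (K, M)) (by simp [step, hb]))
    exact this

theorem Runs.expectedTime_eq {P : Prog} {M M' : Mem} {t : ℕ} (h : Runs P M t M') :
    expectedTime P M = t := by
  have := (h.reaches []).2
  rw [timeFrom_nil, add_zero] at this
  exact this

theorem Runs.haltProb_eq {P : Prog} {M M' : Mem} {t : ℕ} (h : Runs P M t M') {Post : Set Mem}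
    (hM : M' ∈ Post) : haltProb P M Post = 1 := by
  obtain ⟨T, hT⟩ := (h.reaches []).1
  -- After `T` transitions the law is a point mass at a halted configuration, so the term `T` of the
  -- supremum is already `1`.
  refine le_antisymm (iSup_le fun r => ?_) (le_iSup_of_le T ?_)
  · exact (MeasureTheory.measure_mono (Set.subset_univ _)).trans
      ((PMF.toOuterMeasure_apply_eq_one_iff _ _).2 (Set.subset_univ _)).le
  · have := hT 0
    rw [zero_add] at this
    rw [this]
    simp [run, PMF.toOuterMeasure_pure_apply, hM]

/-! ### Counting loops -/

/-- `for c := 0 to e - 1 do body`, with the counter in the integer cell `c`. -/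
def forLoop (c : ℕ) (e : IExpr) (body : Prog) : Prog :=
  .seq (.istore (.const c) (.const 0))
    (.loop (.neg (.ile e (.load (.const c))))
      (.seq body (.istore (.const c) (.add (.load (.const c)) (.const 1)))))

/-- `Inv k` describes the memory at the loop test, with `k` already in the counter. The bound `e` is
evaluated again at each test, so the invariant must force its value to stay `m`. -/
theorem runs_forLoop (c : ℕ) (e : IExpr) (body : Prog) (m b : ℕ) (Inv : ℕ → Mem → Prop)
    (hI : ∀ k M, Inv k M → M.int c = k ∧ e.eval M = m)
    (hb : ∀ k M, k < m → Inv k M → ∃ t M', Runs body M t M' ∧ t ≤ b ∧ M'.int c = k ∧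
      Inv (k + 1) (M'.setInt c (k + 1)))
    (M : Mem) (h0 : Inv 0 (M.setInt c 0)) :
    ∃ t M', Runs (forLoop c e body) M t M' ∧ t ≤ m * (b + e.cost + 20) + e.cost + 20 ∧
      Inv m M' := by
  have key : ∀ d k M, k + d = m → Inv k M →
      ∃ t M', Runs (.loop (.neg (.ile e (.load (.const c))))
        (.seq body (.istore (.const c) (.add (.load (.const c)) (.const 1))))) M t M' ∧
        t ≤ d * (b + e.cost + 20) + e.cost + 10 ∧ Inv m M' := by
    intro d
    induction d with
    | zero =>
      intro k M hk hM
      obtain ⟨h₁, h₂⟩ := hI k M hM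
      refine ⟨_, M, Runs.loop_false ?_, ?_, ?_⟩
      · simp only [Test.Holds, IExpr.eval, h₁, h₂]; omega
      · simp [Test.cost, IExpr.cost]
      · rwa [← hk]
    | succ d ih =>
      intro k M hk hM
      obtain ⟨h₁, h₂⟩ := hI k M hM
      obtain ⟨t, M', r, ht, hc, hM'⟩ := hb k M (by omega) hM
      obtain ⟨t', M'', r', ht', hM''⟩ := ih (k + 1) _ (by omega) hM'
      refine ⟨_, M'', Runs.loop_true ?_ (Runs.seq r (Runs.istore _ _ _)) (t' := t') ?_, ?_, hM''⟩
      · simp only [Test.Holds, IExpr.eval, h₁, h₂]; omega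
      · simpa only [IExpr.eval, hc] using r'
      · simp only [Test.cost, IExpr.cost, add_mul, one_mul]; omega
  obtain ⟨t, M', r, ht, hM'⟩ := key m 0 _ (by simp) h0
  refine ⟨_, M', Runs.seq (Runs.istore _ _ _) r, ?_, hM'⟩
  simp only [IExpr.cost]; omega

end RealRAM

namespace RealRAM

/-! ### A structured view of the memory -/

/-- The data that stay fixed during a computation: the number of variables, the number of terms,
the dimension of the vectors, and the input part of the real memory. -/
structure Env where
  n : ℕ
  N : ℕ
  D : ℕ
  inp : ℕ → ℝ

/-- The structured content of a memory: integer registers, two integer arrays, real registers, and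
a two-dimensional array of vectors. -/
structure St (E : Env) where
  reg : ℕ → ℕ
  idx : ℕ → ℕ
  flag : ℕ → ℕ
  sc : ℕ → ℝ
  row : ℕ → ℕ → Fin E.D → ℝ

/-- The first free address of the real memory. -/
def Env.base (E : Env) : ℕ := E.N * (E.n + 1)

/-- An injective numbering of pairs. -/
def pairNum (l i : ℕ) : ℕ := (l + i) * (l + i) + i

/-- Pairs with `l + i = s` get the numbers from `s ^ 2` to `s ^ 2 + s`, all below `(s + 1) ^ 2`. The
numbering needs no division and no bounds on the indices. -/
theorem pairNum_inj {l i l' i' : ℕ} (h : pairNum l i = pairNum l' i') : l = l' ∧ i = i' := by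
  unfold pairNum at h
  have hs : l + i = l' + i' := by
    rcases lt_trichotomy (l + i) (l' + i') with h' | h' | h'
    · nlinarith
    · exact h'
    · nlinarith
  rw [hs] at h
  omega

/-- Address of the first coordinate of a vector; the coordinates are at distance two. -/
def Env.rowAddr (E : Env) (l i : ℕ) : ℕ := E.base + 1 + 2 * (pairNum l i * E.D)

/-- Quotient and remainder by `E.D` recover the pair number and the coordinate. -/
theorem Env.rowAddr_inj {E : Env} {l i l' i' k k' : ℕ} (hk : k < E.D) (hk' : k' < E.D)
    (h : E.rowAddr l i + 2 * k = E.rowAddr l' i' + 2 * k') : l = l' ∧ i = i' ∧ k = k' := by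
  unfold Env.rowAddr at h
  have h1 : k + E.D * pairNum l i = k' + E.D * pairNum l' i' := by
    rw [mul_comm E.D, mul_comm E.D]; omega
  have hD : 0 < E.D := by omega
  have h2 := congrArg (· / E.D) h1
  simp only [Nat.add_mul_div_left _ _ hD, Nat.div_eq_of_lt hk, Nat.div_eq_of_lt hk',
    zero_add] at h2
  obtain ⟨h3, h4⟩ := pairNum_inj h2
  rw [h2] at h1
  exact ⟨h3, h4, by omega⟩

/-- The memory `M` has the structured content `σ`. The integer cells `4` to `7` are free. -/
structure Rep (E : Env) (M : Mem) (σ : St E) : Prop where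
  n : M.int 0 = E.n
  N : M.int 1 = E.N
  b : M.int 2 = E.base
  D : M.int 3 = E.D
  reg : ∀ r, M.int (8 + 3 * r) = σ.reg r
  idx : ∀ l, M.int (9 + 3 * l) = σ.idx l
  flag : ∀ p, M.int (10 + 3 * p) = σ.flag p
  inp : ∀ a < E.base, M.real a = E.inp a
  sc : ∀ s, M.real (E.base + 2 * s) = σ.sc s
  row : ∀ l i (k : Fin E.D), M.real (E.rowAddr l i + 2 * k) = σ.row l i k

variable {E : Env}

namespace St

def setReg (σ : St E) (r v : ℕ) : St E := { σ with reg := Function.update σ.reg r v }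
def setIdx (σ : St E) (r v : ℕ) : St E := { σ with idx := Function.update σ.idx r v }
def setFlag (σ : St E) (r v : ℕ) : St E := { σ with flag := Function.update σ.flag r v }
def setSc (σ : St E) (s : ℕ) (v : ℝ) : St E := { σ with sc := Function.update σ.sc s v }
def setRow (σ : St E) (l i : ℕ) (v : Fin E.D → ℝ) : St E :=
  { σ with row := Function.update σ.row l (Function.update (σ.row l) i v) }

end St

/-! ### Expressions over the structured memory -/

/-- Integer expressions. -/
inductive IX where
  | k (c : ℕ)
  | n
  | N
  | D
  | reg (r : ℕ)
  | idx (e : IX)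
  | flag (e : IX)
  | add (a b : IX)
  | sub (a b : IX)
  | mul (a b : IX)

def IX.comp : IX → IExpr
  | .k c => .const c
  | .n => .load (.const 0)
  | .N => .load (.const 1)
  | .D => .load (.const 3)
  | .reg r => .load (.const (8 + 3 * r))
  | .idx e => .load (.add (.const 9) (.mul (.const 3) e.comp))
  | .flag e => .load (.add (.const 10) (.mul (.const 3) e.comp))
  | .add a b => .add a.comp b.comp
  | .sub a b => .sub a.comp b.comp
  | .mul a b => .mul a.comp b.comp

def IX.ev (σ : St E) : IX → ℕ
  | .k c => c
  | .n => E.n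
  | .N => E.N
  | .D => E.D
  | .reg r => σ.reg r
  | .idx e => σ.idx (e.ev σ)
  | .flag e => σ.flag (e.ev σ)
  | .add a b => a.ev σ + b.ev σ
  | .sub a b => a.ev σ - b.ev σ
  | .mul a b => a.ev σ * b.ev σ

theorem Rep.ix {M : Mem} {σ : St E} (h : Rep E M σ) (e : IX) : e.comp.eval M = e.ev σ := by
  induction e <;> simp_all [IX.comp, IX.ev, IExpr.eval, h.n, h.N, h.D, h.reg, h.idx, h.flag]

/-- Real expressions. -/
inductive RX where
  | k (c : ℤ)
  | sc (s : ℕ)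
  | add (a b : RX)
  | sub (a b : RX)
  | mul (a b : RX)
  | div (a b : RX)

/-- The address of a real register. -/
def scAddr (s : ℕ) : IExpr := .add (.load (.const 2)) (.const (2 * s))

def RX.comp : RX → RExpr
  | .k c => .const c
  | .sc s => .load (scAddr s)
  | .add a b => .add a.comp b.comp
  | .sub a b => .sub a.comp b.comp
  | .mul a b => .mul a.comp b.comp
  | .div a b => .div a.comp b.comp

noncomputable def RX.ev (σ : St E) : RX → ℝ
  | .k c => c
  | .sc s => σ.sc s
  | .add a b => a.ev σ + b.ev σ
  | .sub a b => a.ev σ - b.ev σ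
  | .mul a b => a.ev σ * b.ev σ
  | .div a b => a.ev σ / b.ev σ

theorem Rep.rx {M : Mem} {σ : St E} (h : Rep E M σ) (e : RX) : e.comp.eval M = e.ev σ := by
  induction e <;> simp_all [RX.comp, RX.ev, RExpr.eval, IExpr.eval, scAddr, h.b, h.sc]

/-- Tests. -/
inductive BX where
  | ile (a b : IX)
  | rle (a b : RX)
  | not (p : BX)
  | and (p q : BX)

def BX.comp : BX → Test
  | .ile a b => .ile a.comp b.comp
  | .rle a b => .rle a.comp b.comp
  | .not p => .neg p.comp
  | .and p q => .conj p.comp q.comp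

def BX.ev (σ : St E) : BX → Prop
  | .ile a b => a.ev σ ≤ b.ev σ
  | .rle a b => a.ev σ ≤ b.ev σ
  | .not p => ¬ p.ev σ
  | .and p q => p.ev σ ∧ q.ev σ

theorem Rep.bx {M : Mem} {σ : St E} (h : Rep E M σ) (e : BX) : e.comp.Holds M ↔ e.ev σ := by
  induction e <;> simp_all [BX.comp, BX.ev, Test.Holds, h.ix, h.rx]

/-! ### Preservation of the structured view -/

theorem Rep.temp {M : Mem} {σ : St E} (h : Rep E M σ) (f : ℕ → ℕ)
    (hf : ∀ a, a < 4 ∨ 8 ≤ a → f a = M.int a) : Rep E ⟨f, M.real⟩ σ where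
  n := by simpa [hf] using h.n
  N := by simpa [hf] using h.N
  b := by simpa [hf] using h.b
  D := by simpa [hf] using h.D
  reg r := by simpa [hf] using h.reg r
  idx r := by rw [← h.idx]; exact hf _ (by omega)
  flag r := by rw [← h.flag]; exact hf _ (by omega)
  inp := h.inp
  sc := h.sc
  row := h.row

theorem Rep.setReg {M : Mem} {σ : St E} (h : Rep E M σ) (r v : ℕ) :
    Rep E (M.setInt (8 + 3 * r) v) (σ.setReg r v) where
  n := by simpa [Mem.setInt, show ¬ 0 = 8 + 3 * r by omega] using h.n
  N := by simpa [Mem.setInt, show ¬ 1 = 8 + 3 * r by omega] using h.N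
  b := by simpa [Mem.setInt, show ¬ 2 = 8 + 3 * r by omega] using h.b
  D := by simpa [Mem.setInt, show ¬ 3 = 8 + 3 * r by omega] using h.D
  reg s := by simp [Mem.setInt, Function.update_apply, St.setReg, h.reg]
  idx s := by
    simp [Mem.setInt, St.setReg, h.idx,
      show ¬ 9 + 3 * s = 8 + 3 * r by omega]
  flag s := by
    simp [Mem.setInt, St.setReg, h.flag,
      show ¬ 10 + 3 * s = 8 + 3 * r by omega]
  inp := h.inp
  sc := h.sc
  row := h.row

theorem Rep.setIdx {M : Mem} {σ : St E} (h : Rep E M σ) (r v : ℕ) :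
    Rep E (M.setInt (9 + 3 * r) v) (σ.setIdx r v) where
  n := by simpa [Mem.setInt, show ¬ 0 = 9 + 3 * r by omega] using h.n
  N := by simpa [Mem.setInt, show ¬ 1 = 9 + 3 * r by omega] using h.N
  b := by simpa [Mem.setInt, show ¬ 2 = 9 + 3 * r by omega] using h.b
  D := by simpa [Mem.setInt, show ¬ 3 = 9 + 3 * r by omega] using h.D
  idx s := by simp [Mem.setInt, Function.update_apply, St.setIdx, h.idx]
  reg s := by
    simp [Mem.setInt, St.setIdx, h.reg,
      show ¬ 8 + 3 * s = 9 + 3 * r by omega]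
  flag s := by
    simp [Mem.setInt, St.setIdx, h.flag,
      show ¬ 10 + 3 * s = 9 + 3 * r by omega]
  inp := h.inp
  sc := h.sc
  row := h.row

theorem Rep.setFlag {M : Mem} {σ : St E} (h : Rep E M σ) (r v : ℕ) :
    Rep E (M.setInt (10 + 3 * r) v) (σ.setFlag r v) where
  n := by simpa [Mem.setInt, show ¬ 0 = 10 + 3 * r by omega] using h.n
  N := by simpa [Mem.setInt, show ¬ 1 = 10 + 3 * r by omega] using h.N
  b := by simpa [Mem.setInt, show ¬ 2 = 10 + 3 * r by omega] using h.b
  D := by simpa [Mem.setInt, show ¬ 3 = 10 + 3 * r by omega] using h.D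
  flag s := by simp [Mem.setInt, Function.update_apply, St.setFlag, h.flag]
  reg s := by
    simp [Mem.setInt, St.setFlag, h.reg,
      show ¬ 8 + 3 * s = 10 + 3 * r by omega]
  idx s := by
    simp [Mem.setInt, St.setFlag, h.idx,
      show ¬ 9 + 3 * s = 10 + 3 * r by omega]
  inp := h.inp
  sc := h.sc
  row := h.row

theorem Rep.setSc {M : Mem} {σ : St E} (h : Rep E M σ) (s : ℕ) (v : ℝ) :
    Rep E (M.setReal (E.base + 2 * s) v) (σ.setSc s v) where
  n := h.n
  N := h.N
  b := h.b
  D := h.D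
  reg := h.reg
  idx := h.idx
  flag := h.flag
  inp a ha := by
    simp [Mem.setReal, h.inp a ha,
      show ¬ a = E.base + 2 * s by omega]
  sc r := by simp [Mem.setReal, Function.update_apply, St.setSc, h.sc]
  row l i k := by
    have := h.row l i k
    simp only [Env.rowAddr] at this
    simp [Mem.setReal, St.setSc, this, Env.rowAddr,
      show ¬ E.base + 1 + 2 * (pairNum l i * E.D) + 2 * (k : ℕ) = E.base + 2 * s by omega]

/-- Write `v 0, …, v (m - 1)` at the addresses `b, b + 2, …`. -/
def overlay (f : ℕ → ℝ) (b m : ℕ) (v : ℕ → ℝ) : ℕ → ℝ := fun a =>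
  if b ≤ a ∧ (a - b) % 2 = 0 ∧ (a - b) / 2 < m then v ((a - b) / 2) else f a

theorem overlay_zero (f : ℕ → ℝ) (b : ℕ) (v : ℕ → ℝ) : overlay f b 0 v = f := by
  funext a; simp [overlay]

theorem overlay_succ (f : ℕ → ℝ) (b m : ℕ) (v : ℕ → ℝ) :
    Function.update (overlay f b m v) (b + 2 * m) (v m) = overlay f b (m + 1) v := by
  funext a
  by_cases h : a = b + 2 * m
  · subst h
    simp [overlay]
  · rw [Function.update_of_ne h]
    unfold overlay
    have : (b ≤ a ∧ (a - b) % 2 = 0 ∧ (a - b) / 2 < m) ↔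
        (b ≤ a ∧ (a - b) % 2 = 0 ∧ (a - b) / 2 < m + 1) := by omega
    simp only [this]

theorem overlay_add (f : ℕ → ℝ) (b m : ℕ) (v : ℕ → ℝ) (k : ℕ) :
    overlay f b m v (b + 2 * k) = if k < m then v k else f (b + 2 * k) := by
  simp [overlay]

theorem overlay_of_ne (f : ℕ → ℝ) (b m : ℕ) (v : ℕ → ℝ) (a : ℕ)
    (h : ∀ k < m, a ≠ b + 2 * k) : overlay f b m v a = f a := by
  unfold overlay
  rw [if_neg]
  rintro ⟨h1, h2, h3⟩
  exact h _ h3 (by omega)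

/-- Vectors occupy odd offsets from `E.base` and real registers even ones, so writing a vector
disturbs neither these nor the input. Partial writes, `m < E.D`, occur when a point is loaded
without its padding. -/
theorem Rep.setRow {M : Mem} {σ : St E} (h : Rep E M σ) (l i m : ℕ) (v : ℕ → ℝ) (hm : m ≤ E.D) :
    Rep E ⟨M.int, overlay M.real (E.rowAddr l i) m v⟩
      (σ.setRow l i (fun k => if (k : ℕ) < m then v k else σ.row l i k)) where
  n := h.n
  N := h.N
  b := h.b
  D := h.D
  reg := h.reg
  idx := h.idx
  flag := h.flag
  inp a ha := by
    rw [← h.inp a ha]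
    exact overlay_of_ne _ _ _ _ _ fun k _ => by unfold Env.rowAddr; omega
  sc r := by
    simp only [St.setRow]
    rw [← h.sc]
    exact overlay_of_ne _ _ _ _ _ fun k _ => by unfold Env.rowAddr; omega
  row l' i' k := by
    simp only [St.setRow]
    by_cases hli : l' = l ∧ i' = i
    · obtain ⟨rfl, rfl⟩ := hli
      rw [Function.update_self, Function.update_self, overlay_add, h.row]
    · have : overlay M.real (E.rowAddr l i) m v (E.rowAddr l' i' + 2 * k) = σ.row l' i' k := by
        rw [← h.row]
        refine overlay_of_ne _ _ _ _ _ fun k' hk' he => hli ?_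
        have := Env.rowAddr_inj k.2 (by omega) he
        exact ⟨this.1, this.2.1⟩
      rw [this]
      by_cases hl : l' = l
      · subst hl
        rw [Function.update_self, Function.update_of_ne (by tauto)]
      · rw [Function.update_of_ne hl]

/-! ### Hoare logic with time -/

/-- The unit in which time is counted: a fixed number of vector operations. -/
def Env.unit (E : Env) : ℕ := 1000 * (E.D + 1)

/-- Started with the content `σ`, the program `c` halts within `q` units of time, with a content
that satisfies `Q`. -/
def Exec (c : Prog) (σ : St E) (q : ℕ) (Q : St E → Prop) : Prop :=
  ∀ M, Rep E M σ → ∃ t M' σ', Runs c M t M' ∧ t + 1 ≤ q * E.unit ∧ Rep E M' σ' ∧ Q σ'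

theorem Env.le_unit (E : Env) : 1000 ≤ E.unit := by unfold Env.unit; omega

theorem Exec.mono {c : Prog} {σ : St E} {q q' : ℕ} {Q Q' : St E → Prop} (h : Exec c σ q Q)
    (hq : q ≤ q') (hQ : ∀ σ', Q σ' → Q' σ') : Exec c σ q' Q' := fun M hM => by
  obtain ⟨t, M', σ', h1, h2, h3, h4⟩ := h M hM
  exact ⟨t, M', σ', h1, h2.trans (Nat.mul_le_mul_right _ hq), h3, hQ _ h4⟩

/-- The slack in `t + 1 ≤ q * E.unit` pays for the transition that unfolds `seq`, so that costs
simply add up. -/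
theorem Exec.seq {c d : Prog} {σ : St E} {q r : ℕ} {Q : St E → Prop}
    (h : Exec c σ q (fun σ' => Exec d σ' r Q)) : Exec (.seq c d) σ (q + r) Q := fun M hM => by
  obtain ⟨t, M', σ', h1, h2, h3, h4⟩ := h M hM
  obtain ⟨t', M'', σ'', h1', h2', h3', h4'⟩ := h4 M' h3
  exact ⟨_, M'', σ'', h1.seq h1', by rw [add_mul]; omega, h3', h4'⟩

/-- `Exec.seq` for a first part of cost one. -/
theorem Exec.cons {c d : Prog} {σ : St E} {r : ℕ} {Q : St E → Prop}
    (h : Exec c σ 1 (fun σ' => Exec d σ' r Q)) : Exec (.seq c d) σ (r + 1) Q := by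
  rw [add_comm]; exact h.seq

theorem Exec.skip {σ : St E} {Q : St E → Prop} (h : Q σ) : Exec .skip σ 1 Q := fun M hM =>
  ⟨_, M, σ, Runs.skip M, by have := E.le_unit; omega, hM, h⟩

/-- Both branches are charged, which is harmless for the final bound and avoids maxima; the extra
unit pays for the test. -/
theorem Exec.ite {b : BX} {c d : Prog} {σ : St E} (q r : ℕ) {Q : St E → Prop}
    (hc : b.ev σ → Exec c σ q Q) (hd : ¬ b.ev σ → Exec d σ r Q)
    (hb : b.comp.cost ≤ 500 := by decide) : Exec (.ite b.comp c d) σ (q + r + 1) Q := fun M hM => by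
  have hu := E.le_unit
  by_cases h : b.ev σ
  · obtain ⟨t, M', σ', h1, h2, h3, h4⟩ := hc h M hM
    exact ⟨_, M', σ', Runs.ite_true ((hM.bx b).2 h) h1, by rw [add_mul, add_mul]; omega, h3, h4⟩
  · obtain ⟨t, M', σ', h1, h2, h3, h4⟩ := hd h M hM
    exact ⟨_, M', σ', Runs.ite_false (mt (hM.bx b).1 h) h1, by rw [add_mul, add_mul]; omega, h3, h4⟩

theorem Exec.loop_false {b : BX} {c : Prog} {σ : St E} {Q : St E → Prop}
    (h : ¬ b.ev σ) (hQ : Q σ) (hb : b.comp.cost ≤ 500 := by decide) :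
    Exec (.loop b.comp c) σ 1 Q := fun M hM =>
  ⟨_, M, σ, Runs.loop_false (mt (hM.bx b).1 h), by have := E.le_unit; omega, hM, hQ⟩

theorem Exec.loop_true {b : BX} {c : Prog} {σ : St E} {q r : ℕ} {Q : St E → Prop}
    (h : b.ev σ) (hc : Exec c σ q (fun σ' => Exec (.loop b.comp c) σ' r Q))
    (hb : b.comp.cost ≤ 500 := by decide) :
    Exec (.loop b.comp c) σ (1 + q + r) Q := fun M hM => by
  have hu := E.le_unit
  obtain ⟨t, M', σ', h1, h2, h3, h4⟩ := hc M hM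
  obtain ⟨t', M'', σ'', h1', h2', h3', h4'⟩ := h4 M' h3
  exact ⟨_, M'', σ'', Runs.loop_true ((hM.bx b).2 h) h1 h1', by rw [add_mul, add_mul]; omega,
    h3', h4'⟩

/-- `for reg r := 0 to e - 1 do c`. -/
def forReg (r : ℕ) (e : IX) (c : Prog) : Prog := forLoop (8 + 3 * r) e.comp c

/-- Here `I k` speaks of the content before the counter receives the value `k`; the body starts
after that. -/
theorem Exec.forReg {r : ℕ} {e : IX} {c : Prog} {σ : St E} {q m : ℕ} (I : ℕ → St E → Prop)
    (he : e.comp.cost ≤ 500 := by decide)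
    (hm : ∀ k σ', k ≤ m → I k σ' → e.ev (σ'.setReg r k) = m)
    (h0 : I 0 σ)
    (hc : ∀ k σ', k < m → I k σ' → Exec c (σ'.setReg r k) q (fun σ'' => σ''.reg r = k ∧ I (k + 1) σ''))
    {Q : St E → Prop} (hQ : ∀ σ', I m σ' → Q (σ'.setReg r m)) :
    Exec (RealRAM.forReg r e c) σ (m * (q + 1) + 1) Q := fun M hM => by
  have hu := E.le_unit
  obtain ⟨t, M', h1, h2, h3, σ', h4, h5⟩ := runs_forLoop (8 + 3 * r) e.comp c m (q * E.unit)
    (fun k M => k ≤ m ∧ ∃ σ', I k σ' ∧ Rep E M (σ'.setReg r k))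
    (by
      rintro k M ⟨hk, σ', h1, h2⟩
      exact ⟨by rw [h2.reg]; simp [St.setReg], by rw [h2.ix, hm k σ' hk h1]⟩)
    (by
      rintro k M hk ⟨-, σ', h1, h2⟩
      obtain ⟨t, M', σ'', h3, h4, h5, h6, h7⟩ := hc k σ' hk h1 M h2
      exact ⟨t, M', h3, by omega, by rw [h5.reg, h6], hk, σ'', h7, h5.setReg _ _⟩)
    M ⟨Nat.zero_le _, σ, h0, hM.setReg _ _⟩
  refine ⟨t, M', _, h1, ?_, h5, hQ _ h4⟩
  have : m * (q * E.unit + e.comp.cost + 20) ≤ m * ((q + 1) * E.unit) :=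
    Nat.mul_le_mul_left _ (by rw [add_mul]; omega)
  rw [add_mul, mul_assoc]
  omega

/-! ### Scalar instructions -/

def setReg (r : ℕ) (e : IX) : Prog := .istore (.const (8 + 3 * r)) e.comp
def setIdx (l e : IX) : Prog := .istore (.add (.const 9) (.mul (.const 3) l.comp)) e.comp
def setFlag (l e : IX) : Prog := .istore (.add (.const 10) (.mul (.const 3) l.comp)) e.comp
def setSc (s : ℕ) (e : RX) : Prog := .rstore (scAddr s) e.comp

theorem Exec.setReg {r : ℕ} {e : IX} {σ : St E} {Q : St E → Prop} (h : Q (σ.setReg r (e.ev σ)))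
    (he : e.comp.cost ≤ 400 := by decide) : Exec (RealRAM.setReg r e) σ 1 Q := fun M hM =>
  ⟨_, _, _, Runs.istore _ _ _, by have := E.le_unit; simp only [IExpr.cost]; omega,
    by simpa only [hM.ix, IExpr.eval] using hM.setReg r (e.ev σ), h⟩

theorem Exec.setIdx {l e : IX} {σ : St E} {Q : St E → Prop} (h : Q (σ.setIdx (l.ev σ) (e.ev σ)))
    (he : l.comp.cost + e.comp.cost ≤ 400 := by decide) :
    Exec (RealRAM.setIdx l e) σ 1 Q := fun M hM =>
  ⟨_, _, _, Runs.istore _ _ _, by have := E.le_unit; simp only [IExpr.cost]; omega,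
    by simpa only [hM.ix, IExpr.eval] using hM.setIdx (l.ev σ) (e.ev σ), h⟩

theorem Exec.setFlag {l e : IX} {σ : St E} {Q : St E → Prop} (h : Q (σ.setFlag (l.ev σ) (e.ev σ)))
    (he : l.comp.cost + e.comp.cost ≤ 400 := by decide) :
    Exec (RealRAM.setFlag l e) σ 1 Q := fun M hM =>
  ⟨_, _, _, Runs.istore _ _ _, by have := E.le_unit; simp only [IExpr.cost]; omega,
    by simpa only [hM.ix, IExpr.eval] using hM.setFlag (l.ev σ) (e.ev σ), h⟩

theorem Exec.setSc {s : ℕ} {e : RX} {σ : St E} {Q : St E → Prop} (h : Q (σ.setSc s (e.ev σ)))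
    (he : e.comp.cost ≤ 400 := by decide) : Exec (RealRAM.setSc s e) σ 1 Q := fun M hM =>
  ⟨_, _, _, Runs.rstore _ _ _, by have := E.le_unit; simp only [IExpr.cost, scAddr]; omega,
    by simpa only [hM.rx, IExpr.eval, scAddr, hM.b] using hM.setSc s (e.ev σ), h⟩

/-! ### Vector instructions -/

/-- Put the address of the row `(l, i)` into the integer cell `c`. -/
def rowTo (c : ℕ) (l i : IX) : Prog :=
  .istore (.const c) (.add (.add (.load (.const 2)) (.const 1)) (.mul (.const 2)
    (.mul (.add (.mul (.add l.comp i.comp) (.add l.comp i.comp)) i.comp) (.load (.const 3)))))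

theorem rowTo_runs {M : Mem} {σ : St E} (h : Rep E M σ) (c : ℕ) (l i : IX) :
    Runs (rowTo c l i) M (2 * l.comp.cost + 3 * i.comp.cost + 16)
      (M.setInt c (E.rowAddr (l.ev σ) (i.ev σ))) := by
  have := Runs.istore (.const c) (.add (.add (.load (.const 2)) (.const 1)) (.mul (.const 2)
    (.mul (.add (.mul (.add l.comp i.comp) (.add l.comp i.comp)) i.comp) (.load (.const 3))))) M
  simp only [IExpr.eval, h.ix, h.b, h.D] at this
  unfold rowTo
  convert this using 1
  · simp only [IExpr.cost]; ring
  · rfl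

/-- For `k < e`, write the value of `v` at the `k`-th coordinate of the row whose address is in
cell `4`; the counter is cell `7`. -/
def rowWrite (e : IExpr) (v : RExpr) : Prog :=
  forLoop 7 e (.rstore (.add (.load (.const 4)) (.mul (.const 2) (.load (.const 7)))) v)

/-- In `hv` the expression is evaluated in a memory where the first `k` coordinates are already
overwritten, so that a source may overlap the target. -/
theorem rowWrite_runs (e : IExpr) (v : RExpr) (m b : ℕ) (f : ℕ → ℝ) (M : Mem)
    (hb : M.int 4 = b)
    (he : ∀ k x, e.eval ⟨Function.update M.int 7 k, x⟩ = m)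
    (hv : ∀ k < m, v.eval ⟨Function.update M.int 7 k, overlay M.real b k f⟩ = f k) :
    ∃ t, Runs (rowWrite e v) M t ⟨Function.update M.int 7 m, overlay M.real b m f⟩ ∧
      t ≤ m * (v.cost + e.cost + 40) + e.cost + 20 := by
  obtain ⟨t, M', h1, h2, h3⟩ := runs_forLoop 7 e
    (.rstore (.add (.load (.const 4)) (.mul (.const 2) (.load (.const 7)))) v) m (v.cost + 20)
    (fun k M' => M' = ⟨Function.update M.int 7 k, overlay M.real b k f⟩)
    (by rintro k _ rfl; exact ⟨by simp, he k _⟩)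
    (by
      rintro k _ hk rfl
      refine ⟨_, _, Runs.rstore _ _ _, by simp only [IExpr.cost]; omega, by simp [Mem.setReal], ?_⟩
      simp [Mem.setReal, Mem.setInt, IExpr.eval, hv k hk, hb, overlay_succ])
    M (by simp [Mem.setInt, overlay_zero])
  subst h3
  exact ⟨t, h1, h2.trans (by
    have : m * (v.cost + 20 + e.cost + 20) = m * (v.cost + e.cost + 40) := by ring
    omega)⟩

/-- `row (l, i) := row (l', i') + sc s • row (l'', i'')`. -/
def axpy (l i l' i' : IX) (s : ℕ) (l'' i'' : IX) : Prog :=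
  .seq (rowTo 4 l i) (.seq (rowTo 5 l' i') (.seq (rowTo 6 l'' i'')
    (rowWrite (.load (.const 3))
      (.add (.load (.add (.load (.const 5)) (.mul (.const 2) (.load (.const 7)))))
        (.mul (.load (scAddr s))
          (.load (.add (.load (.const 6)) (.mul (.const 2) (.load (.const 7))))))))))

theorem update_temp (f : ℕ → ℕ) (c v : ℕ) (hc : 4 ≤ c ∧ c < 8) (a : ℕ) (ha : a < 4 ∨ 8 ≤ a) :
    Function.update f c v a = f a :=
  Function.update_of_ne (by omega) _ _

theorem Rep.setTemp {M : Mem} {σ : St E} (h : Rep E M σ) (c v : ℕ) (hc : 4 ≤ c ∧ c < 8) :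
    Rep E (M.setInt c v) σ :=
  h.temp _ (update_temp _ _ _ hc)

/-- The rows `(l, i)` and `(l', i')` may coincide: coordinate `k` is read before it is written. This
allows `axpy` to work in place. -/
theorem Rep.overlay_row {M : Mem} {σ : St E} (h : Rep E M σ) (l i l' i' : ℕ) {k : ℕ} (f : ℕ → ℝ)
    (hk : k < E.D) :
    overlay M.real (E.rowAddr l i) k f (E.rowAddr l' i' + 2 * k) = σ.row l' i' ⟨k, hk⟩ := by
  rw [overlay_of_ne, ← h.row]
  intro j hj he
  have := Env.rowAddr_inj hk (by omega) he
  omega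

theorem Rep.overlay_sc {M : Mem} {σ : St E} (h : Rep E M σ) (l i s : ℕ) {k : ℕ} (f : ℕ → ℝ) :
    overlay M.real (E.rowAddr l i) k f (E.base + 2 * s) = σ.sc s := by
  rw [overlay_of_ne, ← h.sc]
  intro j hj he
  unfold Env.rowAddr at he
  omega

theorem Exec.axpy {l i l' i' l'' i'' : IX} {s : ℕ} {σ : St E} {Q : St E → Prop}
    {v : Fin E.D → ℝ}
    (hv : σ.row (l'.ev σ) (i'.ev σ) + σ.sc s • σ.row (l''.ev σ) (i''.ev σ) = v)
    (h : Q (σ.setRow (l.ev σ) (i.ev σ) v))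
    (hc : l.comp.cost + l'.comp.cost + l''.comp.cost + i.comp.cost + i'.comp.cost +
      i''.comp.cost ≤ 200 := by decide) :
    Exec (RealRAM.axpy l i l' i' s l'' i'') σ 1 Q := fun M hM => by
  subst hv
  have r1 := rowTo_runs hM 4 l i
  have hM1 := hM.setTemp 4 (E.rowAddr (l.ev σ) (i.ev σ)) (by omega)
  have r2 := rowTo_runs hM1 5 l' i'
  have hM2 := hM1.setTemp 5 (E.rowAddr (l'.ev σ) (i'.ev σ)) (by omega)
  have r3 := rowTo_runs hM2 6 l'' i''
  have hM3 := hM2.setTemp 6 (E.rowAddr (l''.ev σ) (i''.ev σ)) (by omega)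
  set M3 := ((M.setInt 4 (E.rowAddr (l.ev σ) (i.ev σ))).setInt 5
    (E.rowAddr (l'.ev σ) (i'.ev σ))).setInt 6 (E.rowAddr (l''.ev σ) (i''.ev σ)) with hM3'
  obtain ⟨t, r4, ht⟩ := rowWrite_runs (.load (.const 3))
    (.add (.load (.add (.load (.const 5)) (.mul (.const 2) (.load (.const 7)))))
        (.mul (.load (scAddr s))
          (.load (.add (.load (.const 6)) (.mul (.const 2) (.load (.const 7)))))))
    E.D (E.rowAddr (l.ev σ) (i.ev σ))
    (fun k => if hk : k < E.D then σ.row (l'.ev σ) (i'.ev σ) ⟨k, hk⟩ +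
      σ.sc s * σ.row (l''.ev σ) (i''.ev σ) ⟨k, hk⟩ else 0) M3
    (by simp [hM3', Mem.setInt])
    (by intro k x; simpa [IExpr.eval] using hM3.D)
    (by
      intro k hk
      have e2 : M3.int 2 = E.base := hM3.b
      have e5 : M3.int 5 = E.rowAddr (l'.ev σ) (i'.ev σ) := by simp [hM3', Mem.setInt]
      have e6 : M3.int 6 = E.rowAddr (l''.ev σ) (i''.ev σ) := by simp [hM3', Mem.setInt]
      simp [RExpr.eval, IExpr.eval, scAddr, e2, e5, e6, hM3.overlay_row _ _ _ _ _ hk,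
        hM3.overlay_sc, hk])
  have hR := ((hM3.setRow (l.ev σ) (i.ev σ) E.D (fun k => if hk : k < E.D then
      σ.row (l'.ev σ) (i'.ev σ) ⟨k, hk⟩ +
      σ.sc s * σ.row (l''.ev σ) (i''.ev σ) ⟨k, hk⟩ else 0) le_rfl).setTemp 7 E.D (by omega))
  refine ⟨_, _, _, r1.seq (r2.seq (r3.seq r4)), ?_, hR, ?_⟩
  · simp only [RExpr.cost, IExpr.cost, scAddr] at ht
    unfold Env.unit
    omega
  · convert h using 2
    funext k
    simp

/-- `sc s := row (l, i) ⬝ row (l', i')`. -/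
def dot (s : ℕ) (l i l' i' : IX) : Prog :=
  .seq (rowTo 5 l i) (.seq (rowTo 6 l' i') (.seq (.rstore (scAddr s) (.const 0))
    (forLoop 7 (.load (.const 3)) (.rstore (scAddr s) (.add (.load (scAddr s))
      (.mul (.load (.add (.load (.const 5)) (.mul (.const 2) (.load (.const 7)))))
          (.load (.add (.load (.const 6)) (.mul (.const 2) (.load (.const 7)))))))))))

theorem Exec.dot {s : ℕ} {l i l' i' : IX} {σ : St E} {Q : St E → Prop} {v : ℝ}
    (hv : dotProduct (σ.row (l.ev σ) (i.ev σ)) (σ.row (l'.ev σ) (i'.ev σ)) = v)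
    (h : Q (σ.setSc s v))
    (hc : l.comp.cost + l'.comp.cost + i.comp.cost + i'.comp.cost ≤ 200 := by decide) :
    Exec (RealRAM.dot s l i l' i') σ 1 Q := fun M hM => by
  subst hv
  have r1 := rowTo_runs hM 5 l i
  have hM1 := hM.setTemp 5 (E.rowAddr (l.ev σ) (i.ev σ)) (by omega)
  have r2 := rowTo_runs hM1 6 l' i'
  have hM2 := hM1.setTemp 6 (E.rowAddr (l'.ev σ) (i'.ev σ)) (by omega)
  set M2 := (M.setInt 5 (E.rowAddr (l.ev σ) (i.ev σ))).setInt 6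
    (E.rowAddr (l'.ev σ) (i'.ev σ)) with hM2'
  have r3 := Runs.rstore (scAddr s) (.const 0) M2
  have e2 : M2.int 2 = E.base := hM2.b
  have e3 : M2.int 3 = E.D := hM2.D
  have e5 : M2.int 5 = E.rowAddr (l.ev σ) (i.ev σ) := by simp [hM2', Mem.setInt]
  have e6 : M2.int 6 = E.rowAddr (l'.ev σ) (i'.ev σ) := by simp [hM2', Mem.setInt]
  let f : ℕ → ℝ := fun k => if hk : k < E.D then σ.row (l.ev σ) (i.ev σ) ⟨k, hk⟩ *
      σ.row (l'.ev σ) (i'.ev σ) ⟨k, hk⟩ else 0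
  obtain ⟨t, M', r4, ht, rfl⟩ := runs_forLoop 7 (.load (.const 3))
    (.rstore (scAddr s) (.add (.load (scAddr s))
      (.mul (.load (.add (.load (.const 5)) (.mul (.const 2) (.load (.const 7)))))
          (.load (.add (.load (.const 6)) (.mul (.const 2) (.load (.const 7)))))))) E.D 50
    (fun k M' => M' = ⟨Function.update M2.int 7 k, Function.update M2.real (E.base + 2 * s)
      (∑ j ∈ Finset.range k, f j)⟩)
    (by rintro k _ rfl; exact ⟨by simp, by simp [IExpr.eval, e3]⟩)
    (by
      rintro k _ hk rfl
      refine ⟨_, _, Runs.rstore _ _ _, by simp [RExpr.cost, IExpr.cost, scAddr],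
        by simp [Mem.setReal], ?_⟩
      have n5 : ¬ E.rowAddr (l.ev σ) (i.ev σ) + 2 * k = E.base + 2 * s := by
        unfold Env.rowAddr; omega
      have n6 : ¬ E.rowAddr (l'.ev σ) (i'.ev σ) + 2 * k = E.base + 2 * s := by
        unfold Env.rowAddr; omega
      have v5 := hM2.row (l.ev σ) (i.ev σ) ⟨k, hk⟩
      have v6 := hM2.row (l'.ev σ) (i'.ev σ) ⟨k, hk⟩
      simp only at v5 v6
      simp [Mem.setReal, Mem.setInt, RExpr.eval, IExpr.eval, scAddr, e2, e5, e6,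
        Finset.sum_range_succ, Function.update_apply, n5, n6, v5, v6, f, hk])
    (M2.setReal (IExpr.eval M2 (scAddr s)) (RExpr.eval M2 (.const 0)))
    (by simp [Mem.setInt, Mem.setReal, IExpr.eval, RExpr.eval, scAddr, e2])
  have hR := (hM2.setSc s (∑ j ∈ Finset.range E.D, f j)).setTemp 7 E.D (by omega)
  refine ⟨_, _, _, r1.seq (r2.seq (r3.seq r4)), ?_, hR, ?_⟩
  · simp only [RExpr.cost, IExpr.cost, scAddr] at ht ⊢
    unfold Env.unit
    omega
  · convert h using 2
    rw [dotProduct, Finset.sum_range]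
    exact Finset.sum_congr rfl fun k _ => by simp [f]

/-- Overwrite the first `n` coordinates of the row `(l, i)` by the difference of the exponents of
the input terms `a` and `b`. -/
def loadDiff (l i a b : IX) : Prog :=
  .seq (rowTo 4 l i) (.seq (.istore (.const 5)
      (.add (.mul a.comp (.add (.load (.const 0)) (.const 1))) (.const 1)))
    (.seq (.istore (.const 6)
      (.add (.mul b.comp (.add (.load (.const 0)) (.const 1))) (.const 1)))
    (rowWrite (.load (.const 0))
      (.sub (.load (.add (.load (.const 5)) (.load (.const 7))))
          (.load (.add (.load (.const 6)) (.load (.const 7))))))))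

/-- The exponents of the `i`-th input term, padded with zeros. -/
def Env.point (E : Env) (i : ℕ) : Fin E.D → ℝ := fun k =>
  if (k : ℕ) < E.n then E.inp (i * (E.n + 1) + 1 + k) else 0

theorem Env.lt_base {E : Env} {a k : ℕ} (ha : a < E.N) (hk : k < E.n) :
    a * (E.n + 1) + 1 + k < E.base := by
  unfold Env.base
  have : (a + 1) * (E.n + 1) ≤ E.N * (E.n + 1) := Nat.mul_le_mul_right _ ha
  rw [add_mul] at this
  omega

theorem Exec.loadDiff {l i a b : IX} {σ : St E} {Q : St E → Prop} (hn : E.n ≤ E.D)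
    (ha : a.ev σ < E.N) (hb : b.ev σ < E.N) (h0 : σ.row (l.ev σ) (i.ev σ) = 0)
    (h : Q (σ.setRow (l.ev σ) (i.ev σ) (E.point (a.ev σ) - E.point (b.ev σ))))
    (hc : l.comp.cost + i.comp.cost + a.comp.cost + b.comp.cost ≤ 200 := by decide) :
    Exec (RealRAM.loadDiff l i a b) σ 1 Q := fun M hM => by
  have r1 := rowTo_runs hM 4 l i
  have hM1 := hM.setTemp 4 (E.rowAddr (l.ev σ) (i.ev σ)) (by omega)
  have r2 := Runs.istore (.const 5)
      (.add (.mul a.comp (.add (.load (.const 0)) (.const 1))) (.const 1))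
      (M.setInt 4 (E.rowAddr (l.ev σ) (i.ev σ)))
  simp only [IExpr.eval, hM1.ix, hM1.n] at r2
  have hM2 := hM1.setTemp 5 (a.ev σ * (E.n + 1) + 1) (by omega)
  have r3 := Runs.istore (.const 6)
      (.add (.mul b.comp (.add (.load (.const 0)) (.const 1))) (.const 1))
      ((M.setInt 4 (E.rowAddr (l.ev σ) (i.ev σ))).setInt 5 (a.ev σ * (E.n + 1) + 1))
  simp only [IExpr.eval, hM2.ix, hM2.n] at r3
  have hM3 := hM2.setTemp 6 (b.ev σ * (E.n + 1) + 1) (by omega)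
  set M3 := ((M.setInt 4 (E.rowAddr (l.ev σ) (i.ev σ))).setInt 5
    (a.ev σ * (E.n + 1) + 1)).setInt 6 (b.ev σ * (E.n + 1) + 1) with hM3'
  let f : ℕ → ℝ := fun k => E.inp (a.ev σ * (E.n + 1) + 1 + k) -
    E.inp (b.ev σ * (E.n + 1) + 1 + k)
  obtain ⟨t, r4, ht⟩ := rowWrite_runs (.load (.const 0))
    (.sub (.load (.add (.load (.const 5)) (.load (.const 7))))
          (.load (.add (.load (.const 6)) (.load (.const 7)))))
    E.n (E.rowAddr (l.ev σ) (i.ev σ)) f M3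
    (by simp [hM3', Mem.setInt])
    (by intro k x; simpa [IExpr.eval] using hM3.n)
    (by
      intro k hk
      have e5 : M3.int 5 = a.ev σ * (E.n + 1) + 1 := by simp [hM3', Mem.setInt]
      have e6 : M3.int 6 = b.ev σ * (E.n + 1) + 1 := by simp [hM3', Mem.setInt]
      have ov : ∀ x < E.base, overlay M3.real (E.rowAddr (l.ev σ) (i.ev σ)) k f x = E.inp x := by
        intro x hx
        rw [overlay_of_ne, hM3.inp x hx]
        intro j _
        unfold Env.rowAddr; omega
      simp [RExpr.eval, IExpr.eval, e5, e6, ov _ (Env.lt_base ha hk), ov _ (Env.lt_base hb hk), f])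
  have hR := (hM3.setRow (l.ev σ) (i.ev σ) E.n f hn).setTemp 7 E.n (by omega)
  refine ⟨_, _, _, r1.seq (r2.seq (r3.seq r4)), ?_, hR, ?_⟩
  · simp only [RExpr.cost, IExpr.cost] at ht ⊢
    unfold Env.unit
    have : E.n * 50 ≤ E.D * 50 := Nat.mul_le_mul_right _ hn
    omega
  -- Only the first `n` coordinates are written; the padding is right because the row was zero by
  -- `h0`.
  · convert h using 2
    funext k
    by_cases hk : (k : ℕ) < E.n <;> simp [f, Env.point, hk, h0]

/-- Set the register `r` to `1` if all coordinates of the row `(l, i)` are nonnegative, and to `0`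
otherwise. -/
def allNonneg (r : ℕ) (l i : IX) : Prog :=
  .seq (rowTo 5 l i) (.seq (.istore (.const (8 + 3 * r)) (.const 1))
    (forLoop 7 (.load (.const 3))
      (.ite (.rle (.const 0) (.load (.add (.load (.const 5)) (.mul (.const 2) (.load (.const 7))))))
        .skip (.istore (.const (8 + 3 * r)) (.const 0)))))

open Classical in
theorem Exec.allNonneg {r : ℕ} {l i : IX} {σ : St E} {Q : St E → Prop}
    (h : Q (σ.setReg r (if 0 ≤ σ.row (l.ev σ) (i.ev σ) then 1 else 0)))
    (hc : l.comp.cost + i.comp.cost ≤ 200 := by decide) :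
    Exec (RealRAM.allNonneg r l i) σ 1 Q := fun M hM => by
  have r1 := rowTo_runs hM 5 l i
  have hM1 := hM.setTemp 5 (E.rowAddr (l.ev σ) (i.ev σ)) (by omega)
  set M1 := M.setInt 5 (E.rowAddr (l.ev σ) (i.ev σ)) with hM1'
  have r2 := Runs.istore (.const (8 + 3 * r)) (.const 1) M1
  have e3 : M1.int 3 = E.D := hM1.D
  have e5 : M1.int 5 = E.rowAddr (l.ev σ) (i.ev σ) := by simp [hM1', Mem.setInt]
  -- The content of the register once `k` coordinates have been inspected.
  let g : ℕ → ℕ := fun k => if ∀ j : Fin E.D, (j : ℕ) < k → 0 ≤ σ.row (l.ev σ) (i.ev σ) j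
    then 1 else 0
  have hr : ∀ c < 8, ¬ c = 8 + 3 * r := by omega
  obtain ⟨t, M', r4, ht, rfl⟩ := runs_forLoop 7 (.load (.const 3))
    (.ite (.rle (.const 0) (.load (.add (.load (.const 5)) (.mul (.const 2) (.load (.const 7))))))
        .skip (.istore (.const (8 + 3 * r)) (.const 0))) E.D 50
    (fun k M' => M' = (M1.setInt (8 + 3 * r) (g k)).setInt 7 k)
    (by
      rintro k _ rfl
      exact ⟨by simp [Mem.setInt], by simp [IExpr.eval, e3, Mem.setInt, hr]⟩)
    (by
      rintro k _ hk rfl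
      have v5 := hM1.row (l.ev σ) (i.ev σ) ⟨k, hk⟩
      simp only at v5
      have hev : ((Test.rle (.const 0) (.load (.add (.load (.const 5))
          (.mul (.const 2) (.load (.const 7)))))).Holds ((M1.setInt (8 + 3 * r) (g k)).setInt 7 k))
          ↔ 0 ≤ σ.row (l.ev σ) (i.ev σ) ⟨k, hk⟩ := by
        simp [Test.Holds, RExpr.eval, IExpr.eval, Mem.setInt, hr, e5, v5]
      have hc7 : ∀ x y : ℕ, (((M1.setInt (8 + 3 * r) x).setInt 7 k).setInt (8 + 3 * r) y).setInt 7
          (k + 1) = (M1.setInt (8 + 3 * r) y).setInt 7 (k + 1) := by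
        intro x y
        simp only [Mem.setInt]
        congr 1
        funext a
        simp only [Function.update_apply]
        grind
      by_cases h0 : 0 ≤ σ.row (l.ev σ) (i.ev σ) ⟨k, hk⟩
      · refine ⟨_, _, Runs.ite_true (hev.2 h0) (Runs.skip _), by simp [Test.cost, RExpr.cost,
          IExpr.cost], by simp [Mem.setInt], ?_⟩
        have hg : g (k + 1) = g k := by
          simp only [g]
          congr 1
          refine propext ⟨fun H j hj => H j (by omega), fun H j hj => ?_⟩
          rcases Nat.lt_succ_iff_lt_or_eq.1 hj with hj | hj
          · exact H j hj
          · convert h0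
        rw [hg]
        simp [Mem.setInt]
      · refine ⟨_, _, Runs.ite_false (mt hev.1 h0) (Runs.istore _ _ _), by simp [Test.cost,
          RExpr.cost, IExpr.cost], by simp [Mem.setInt, hr, IExpr.eval], ?_⟩
        have hg : g (k + 1) = 0 := if_neg fun H => h0 (H ⟨k, hk⟩ (Nat.lt_succ_self k))
        rw [hg, ← hc7 (g k) 0]
        rfl)
    _ (by
      have hg : g 0 = 1 := if_pos fun j hj => absurd hj (Nat.not_lt_zero _)
      rw [hg])
  have hR := (hM1.setReg r (g E.D)).setTemp 7 E.D (by omega)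
  refine ⟨_, _, _, r1.seq (r2.seq r4), ?_, hR, ?_⟩
  · simp only [IExpr.cost] at ht ⊢
    unfold Env.unit
    omega
  · convert h using 2
    simp [g, Pi.le_def]

end RealRAM

/-! ### Strict systems of homogeneous linear inequalities -/

namespace StrictSystem

variable {D : ℕ}

/-- The inequalities `0 < w ⬝ a j`, `j < m`, have a common solution `w`. -/
def Feas (a : ℕ → Fin D → ℝ) (m : ℕ) : Prop := ∃ w, ∀ j < m, 0 < w ⬝ᵥ a j

theorem Feas.mono {a : ℕ → Fin D → ℝ} {m k : ℕ} (h : Feas a m) (hk : k ≤ m) : Feas a k :=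
  h.imp fun _ hw j hj => hw j (hj.trans_le hk)

/-- The orthogonal projection of `v` along `p`. -/
noncomputable def projOff (v p : Fin D → ℝ) : Fin D → ℝ := v + (0 - v ⬝ᵥ p / (p ⬝ᵥ p)) • p

theorem dot_self_pos {p : Fin D → ℝ} (hp : p ≠ 0) : 0 < p ⬝ᵥ p := by
  have h0 : 0 ≤ p ⬝ᵥ p := Finset.sum_nonneg fun i _ => mul_self_nonneg (p i)
  exact lt_of_le_of_ne h0 fun h => hp (dotProduct_self_eq_zero.1 h.symm)

theorem projOff_dot {v p : Fin D → ℝ} (hp : p ≠ 0) : projOff v p ⬝ᵥ p = 0 := by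
  have := (dot_self_pos hp).ne'
  simp only [projOff, add_dotProduct, smul_dotProduct, smul_eq_mul]
  field_simp
  ring

/-- The projection is self-adjoint. Hence a solution of the projected constraints yields, after
projection, one of the original constraints. -/
theorem dot_projOff (w v p : Fin D → ℝ) : w ⬝ᵥ projOff v p = projOff w p ⬝ᵥ v := by
  simp only [projOff, add_dotProduct, smul_dotProduct, dotProduct_add, dotProduct_smul,
    smul_eq_mul, dotProduct_comm v p]
  ring

/-- On the way from the violating `w` to a solution `v`, the hyperplane orthogonal to `a i` is met.
The meeting point, up to scaling, has a nonnegative coefficient at `v` and a positive one at `w`, so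
it satisfies the first `i` constraints; being orthogonal to `a i`, it does not see the projection.
-/
theorem Feas.descend {a : ℕ → Fin D → ℝ} {i : ℕ} {w : Fin D → ℝ} (h : Feas a (i + 1))
    (hw : ∀ j < i, 0 < w ⬝ᵥ a j) (hi : ¬ 0 < w ⬝ᵥ a i) :
    Feas (fun j => projOff (a j) (a i)) i := by
  obtain ⟨v, hv⟩ := h
  have hvi := hv i (Nat.lt_succ_self i)
  refine ⟨(-(w ⬝ᵥ a i)) • v + (v ⬝ᵥ a i) • w, fun j hj => ?_⟩
  have h0 : ((-(w ⬝ᵥ a i)) • v + (v ⬝ᵥ a i) • w) ⬝ᵥ a i = 0 := by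
    simp only [add_dotProduct, smul_dotProduct, smul_eq_mul]; ring
  have h1 : 0 < ((-(w ⬝ᵥ a i)) • v + (v ⬝ᵥ a i) • w) ⬝ᵥ a j := by
    simp only [add_dotProduct, smul_dotProduct, smul_eq_mul]
    have := hv j (by omega)
    have := mul_pos hvi (hw j hj)
    have : 0 ≤ -(w ⬝ᵥ a i) * (v ⬝ᵥ a j) := mul_nonneg (by linarith) (by linarith)
    linarith
  simp only [projOff, dotProduct_add, dotProduct_smul, h0, smul_zero, add_zero, h1]

/-- The projected `w` satisfies the first `i` constraints strictly and is orthogonal to `a i`. A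
small `t > 0` preserves these finitely many strict inequalities and makes the value at `a i`
positive. -/
theorem exists_lift {a : ℕ → Fin D → ℝ} {i : ℕ} {w : Fin D → ℝ} (hi : a i ≠ 0)
    (hw : ∀ j < i, 0 < w ⬝ᵥ projOff (a j) (a i)) :
    ∃ t : ℝ, ∀ j < i + 1, 0 < projOff w (a i) ⬝ᵥ a j + t * (a i ⬝ᵥ a j) := by
  have key : ∀ᶠ t : ℝ in nhdsWithin 0 (Set.Ioi 0), ∀ j ∈ Finset.range (i + 1),
      0 < projOff w (a i) ⬝ᵥ a j + t * (a i ⬝ᵥ a j) := by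
    rw [Filter.eventually_all_finset]
    intro j hj
    rcases Nat.lt_succ_iff_lt_or_eq.1 (Finset.mem_range.1 hj) with hj | rfl
    · have h := hw j hj
      rw [dot_projOff] at h
      have hc : Continuous fun t : ℝ => projOff w (a i) ⬝ᵥ a j + t * (a i ⬝ᵥ a j) := by fun_prop
      refine nhdsWithin_le_nhds ?_
      exact (continuousAt_const.eventually_lt hc.continuousAt (x₀ := (0 : ℝ)) (by simpa using h))
    · filter_upwards [self_mem_nhdsWithin] with t ht
      rw [projOff_dot hi, zero_add]
      exact mul_pos ht (dot_self_pos hi)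
  obtain ⟨t, ht⟩ := key.exists
  exact ⟨t, fun j hj => ht j (Finset.mem_range.2 hj)⟩

/-- The vectors orthogonal to `p`. -/
def orth (p : Fin D → ℝ) : Submodule ℝ (Fin D → ℝ) where
  carrier := {v | v ⬝ᵥ p = 0}
  add_mem' := by
    intro a b ha hb
    simp only [Set.mem_ofPred_eq] at *
    rw [add_dotProduct, ha, hb, add_zero]
  zero_mem' := zero_dotProduct p
  smul_mem' := by
    intro c a ha
    simp only [Set.mem_ofPred_eq] at *
    rw [smul_dotProduct, ha, smul_zero]

/-- The intersection is proper since `p` is in `V` and not orthogonal to itself. -/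
theorem finrank_inf_orth {V : Submodule ℝ (Fin D → ℝ)} {d : ℕ} {p : Fin D → ℝ}
    (hV : Module.finrank ℝ V ≤ d + 1) (hp : p ≠ 0) (hpV : p ∈ V) :
    Module.finrank ℝ (V ⊓ orth p : Submodule ℝ (Fin D → ℝ)) ≤ d := by
  have : V ⊓ orth p < V := by
    refine lt_of_le_of_ne inf_le_left fun h => ?_
    rw [← h] at hpV
    exact (dot_self_pos hp).ne' hpV.2
  have := Submodule.finrank_lt_finrank_of_lt this
  omega

theorem projOff_mem {V : Submodule ℝ (Fin D → ℝ)} {v p : Fin D → ℝ} (hp : p ≠ 0) (hpV : p ∈ V)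
    (hv : v ∈ V) : projOff v p ∈ V ⊓ orth p :=
  ⟨V.add_mem hv (V.smul_mem _ hpV), projOff_dot hp⟩

theorem exists_smul_eq_of_finrank {V : Submodule ℝ (Fin D → ℝ)} (hV : Module.finrank ℝ V ≤ 1)
    {y z : Fin D → ℝ} (hy : y ≠ 0) (hyV : y ∈ V) (hz : z ∈ V) : ∃ c : ℝ, z = c • y := by
  obtain ⟨v, hv⟩ := finrank_le_one_iff.1 hV
  obtain ⟨a, ha⟩ := hv ⟨y, hyV⟩
  obtain ⟨b, hb⟩ := hv ⟨z, hz⟩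
  have ha' : a • (v : Fin D → ℝ) = y := congrArg Subtype.val ha
  have hb' : b • (v : Fin D → ℝ) = z := congrArg Subtype.val hb
  have : a ≠ 0 := by rintro rfl; exact hy (by rw [← ha', zero_smul])
  refine ⟨b / a, ?_⟩
  rw [← ha', smul_smul, div_mul_cancel₀ _ this, hb']

/-- In the plane, a solution can be found on the line through a constraint orthogonal to it. -/
theorem Feas.exists_line {a : ℕ → Fin D → ℝ} {m : ℕ} (h : Feas a m) {x y : Fin D → ℝ}
    (hx : 0 < m → x = a 0) (hyx : y ⬝ᵥ x = 0)
    (hy : ∀ j < m, ∃ c : ℝ, projOff (a j) x = c • y) :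
    ∃ t : ℝ, ∀ j < m, 0 < x ⬝ᵥ a j + t * (y ⬝ᵥ a j) := by
  obtain ⟨w, hw⟩ := h
  rcases Nat.eq_zero_or_pos m with rfl | hm
  · exact ⟨0, by simp⟩
  have hwx : 0 < w ⬝ᵥ x := by rw [hx hm]; exact hw 0 hm
  have hx0 : x ≠ 0 := by rintro rfl; simp at hwx
  have hxx := dot_self_pos hx0
  -- If `y = 0`, all constraints are multiples of `x`, and positive ones because `w` is a solution;
  -- then `x` itself is a solution.
  by_cases hy0 : y = 0
  · subst hy0
    refine ⟨0, fun j hj => ?_⟩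
    obtain ⟨c, hc⟩ := hy j hj
    have h1 := hw j hj
    have h2 : a j = (a j ⬝ᵥ x / (x ⬝ᵥ x)) • x := by
      simp only [projOff, smul_zero, zero_sub, neg_smul] at hc
      exact add_neg_eq_zero.1 hc
    rw [h2, dotProduct_smul, smul_eq_mul] at h1
    have h3 : 0 < a j ⬝ᵥ x / (x ⬝ᵥ x) := pos_of_mul_pos_left h1 hwx.le
    rw [zero_mul, add_zero, dotProduct_comm]
    have := mul_pos h3 hxx
    rwa [div_mul_cancel₀ _ hxx.ne'] at this
  · have hyy := dot_self_pos hy0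
    -- Only the component of `w` in the plane of `x` and `y` matters. Its coefficient at `x` is `w
    -- ⬝ᵥ x / (x ⬝ᵥ x) > 0`; dividing by it leaves `x + t • y` with this `t`.
    refine ⟨(x ⬝ᵥ x) * (w ⬝ᵥ y) / ((w ⬝ᵥ x) * (y ⬝ᵥ y)), fun j hj => ?_⟩
    obtain ⟨c, hc⟩ := hy j hj
    have h1 := hw j hj
    have h2 : a j = (a j ⬝ᵥ x / (x ⬝ᵥ x)) • x + c • y := by
      rw [← hc, projOff]; simp
    set r := a j ⬝ᵥ x / (x ⬝ᵥ x) with hr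
    rw [h2] at h1 ⊢
    have hxy : x ⬝ᵥ y = 0 := by rw [dotProduct_comm, hyx]
    simp only [dotProduct_add, dotProduct_smul, smul_eq_mul, hyx, hxy, mul_zero, add_zero,
      zero_add] at h1 ⊢
    have h3 : r * (x ⬝ᵥ x) + (x ⬝ᵥ x) * (w ⬝ᵥ y) / ((w ⬝ᵥ x) * (y ⬝ᵥ y)) * (c * (y ⬝ᵥ y)) =
        (x ⬝ᵥ x) / (w ⬝ᵥ x) * (r * (w ⬝ᵥ x) + c * (w ⬝ᵥ y)) := by
      field_simp
    rw [h3]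
    positivity

end StrictSystem

/-! ### Vertices of Newton polytopes -/

namespace TropPoly

variable {n : ℕ}

theorem lt_convexCombo {a b x y u : ℝ} (ha : 0 < a) (hb : 0 ≤ b) (hab : a + b = 1) (hx : u < x)
    (hy : u ≤ y) : u < a * x + b * y := by
  obtain rfl : b = 1 - a := by linarith
  have := mul_lt_mul_of_pos_left hx ha
  have := mul_le_mul_of_nonneg_left hy hb
  linarith

theorem toPoint_injective : Function.Injective (toPoint (n := n)) := fun μ ν h => by
  ext j
  exact Nat.cast_injective (R := ℝ) (congrFun h j)

theorem vertNP_subset (s : MvPolynomial (Fin n) 𝕋) : vertNP s ⊆ s.support := fun μ hμ => by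
  obtain ⟨ν, hν, h⟩ := extremePoints_convexHull_subset hμ
  rwa [← toPoint_injective h]

/-- A vertex is outside the convex hull of the other points, which is closed as there are finitely
many; Hahn–Banach separates strictly. Conversely, the point is the only minimiser of `w` on the
polytope. -/
theorem mem_vertNP_iff {s : MvPolynomial (Fin n) 𝕋} {μ : Fin n →₀ ℕ} (hμ : μ ∈ s.support) :
    μ ∈ vertNP s ↔
      ∃ w : Fin n → ℝ, ∀ ν ∈ s.support, ν ≠ μ → 0 < w ⬝ᵥ (toPoint ν - toPoint μ) := by
  constructor
  · intro h
    have h1 := ((convex_convexHull ℝ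
      (toPoint '' (s.support : Set (Fin n →₀ ℕ)))).mem_extremePoints_iff_mem_sdiff_convexHull_sdiff.1 h).2
    have hfin : ((toPoint '' (s.support : Set (Fin n →₀ ℕ))) \ {toPoint μ}).Finite :=
      (s.support.finite_toSet.image _).subset Set.sdiff_subset
    have h2 : toPoint μ ∉ convexHull ℝ
        ((toPoint '' (s.support : Set (Fin n →₀ ℕ))) \ {toPoint μ}) := fun hc =>
      h1 (convexHull_mono (Set.sdiff_subset_sdiff_left (subset_convexHull ℝ _)) hc)
    obtain ⟨f, u, hu, hf⟩ := geometric_hahn_banach_point_closed (convex_convexHull ℝ _)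
      (hfin.isClosed_convexHull ℝ) h2
    refine ⟨fun j => f (Pi.single j 1), fun ν hν hne => ?_⟩
    have hrep : ∀ v : Fin n → ℝ, (fun j => f (Pi.single j 1)) ⬝ᵥ v = f v := by
      intro v
      conv_rhs => rw [← Finset.univ_sum_single v, map_sum]
      refine Finset.sum_congr rfl fun j _ => ?_
      rw [show (Pi.single j (v j) : Fin n → ℝ) = v j • Pi.single j 1 by
        rw [← Pi.single_smul, smul_eq_mul, mul_one], map_smul, smul_eq_mul, mul_comm]
    rw [hrep, map_sub, sub_pos]
    exact hu.trans (hf _ (subset_convexHull ℝ _ ⟨⟨ν, hν, rfl⟩, fun he =>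
      hne (toPoint_injective he)⟩))
  · rintro ⟨w, hw⟩
    -- An open half-space together with one boundary point is convex and contains the support, hence
    -- the polytope; that boundary point is extreme in it.
    have hsub : NP s ⊆ insert (toPoint μ) {x | w ⬝ᵥ toPoint μ < w ⬝ᵥ x} := by
      refine convexHull_min ?_ ?_
      · rintro _ ⟨ν, hν, rfl⟩
        by_cases hne : ν = μ
        · exact Or.inl (by rw [hne])
        · have := hw ν hν hne
          rw [dotProduct_sub, sub_pos] at this
          exact Or.inr this
      · intro x hx y hy a b ha hb hab
        have hle : ∀ z ∈ insert (toPoint μ) {x | w ⬝ᵥ toPoint μ < w ⬝ᵥ x},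
            w ⬝ᵥ toPoint μ ≤ w ⬝ᵥ z := by
          rintro z (rfl | hz)
          · exact le_rfl
          · exact le_of_lt hz
        have key : w ⬝ᵥ (a • x + b • y) = a * (w ⬝ᵥ x) + b * (w ⬝ᵥ y) := by
          simp [dotProduct_add, dotProduct_smul]
        rcases eq_or_lt_of_le ha with rfl | ha
        · obtain rfl : b = 1 := by linarith
          simpa using hy
        rcases eq_or_lt_of_le hb with rfl | hb
        · obtain rfl : a = 1 := by linarith
          simpa using hx
        rcases hx with rfl | hx'
        · rcases hy with rfl | hy'
          · left; rw [← add_smul, hab, one_smul]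
          · right
            simp only [Set.mem_ofPred_eq] at hy' ⊢
            rw [key, add_comm]
            exact lt_convexCombo hb ha.le (by linarith) hy' le_rfl
        · right
          have := hle y hy
          simp only [Set.mem_ofPred_eq] at hx' ⊢
          rw [key]
          exact lt_convexCombo ha hb.le hab hx' this
    refine inter_extremePoints_subset_extremePoints_of_subset hsub
      ⟨subset_convexHull ℝ _ ⟨μ, hμ, rfl⟩, Set.mem_insert _ _, ?_⟩
    intro x hx y hy hxy
    obtain ⟨a, b, ha, hb, hab, he⟩ := hxy
    have hw' : w ⬝ᵥ toPoint μ = a * (w ⬝ᵥ x) + b * (w ⬝ᵥ y) := by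
      rw [← he]; simp [dotProduct_add, dotProduct_smul]
    rcases hx with rfl | hx
    · rfl
    · exfalso
      have hx' : w ⬝ᵥ toPoint μ < w ⬝ᵥ x := hx
      have hy' : w ⬝ᵥ toPoint μ ≤ w ⬝ᵥ y := by
        rcases hy with rfl | hy
        · exact le_rfl
        · exact le_of_lt hy
      exact (lt_convexCombo ha hb.le hab hx' hy').ne hw'

/-! ### The support of `sMin` and the vertices of the minimal Newton polytope -/

theorem support_sMin (s : MvPolynomial (Fin n) 𝕋) :
    ((sMin s).support : Set (Fin n →₀ ℕ)) = vertNPmin s ∧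
      ∀ μ ∈ (sMin s).support, (sMin s).coeff μ = 1 := by
  classical
  have hco : ∀ μ, (sMin s).coeff μ = if μ ∈ vertNPmin s then 1 else 0 := by
    intro μ
    rw [sMin, MvPolynomial.coeff_sum]
    simp only [MvPolynomial.coeff_monomial]
    rw [Finset.sum_ite_eq']
    refine if_congr ?_ rfl rfl
    rw [Finset.mem_filter]
    exact ⟨fun h => h.2, fun h => ⟨vertNP_subset s h.prop, h⟩⟩
  have hmem : ∀ μ, μ ∈ (sMin s).support ↔ μ ∈ vertNPmin s := by
    intro μ
    rw [MvPolynomial.mem_support_iff, hco]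
    have h1 : (1 : 𝕋) ≠ 0 := fun h => by simpa using congrArg Tropical.untrop h
    by_cases h : μ ∈ vertNPmin s <;> simp [h, h1]
  refine ⟨Set.ext hmem, fun μ hμ => ?_⟩
  rw [hco, if_pos ((hmem μ).1 hμ)]

/-- Extreme points of a convex hull belong to the generating set. Conversely, each generator is
extreme in `NP s`, hence in the subset `NPmin s`. -/
theorem image_support_sMin (s : MvPolynomial (Fin n) 𝕋) :
    toPoint '' ((sMin s).support : Set (Fin n →₀ ℕ)) = Set.extremePoints ℝ (NPmin s) := by
  rw [(support_sMin s).1]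
  refine Set.Subset.antisymm ?_ extremePoints_convexHull_subset
  rintro _ ⟨μ, hμ, rfl⟩
  have hsub : NPmin s ⊆ NP s := convexHull_mono
    (Set.image_mono fun ν hν => vertNP_subset s (Minimal.prop hν))
  exact inter_extremePoints_subset_extremePoints_of_subset hsub
    ⟨subset_convexHull ℝ _ ⟨μ, hμ, rfl⟩, (Minimal.prop hμ : μ ∈ vertNP s)⟩

end TropPoly

namespace RealRAM

open StrictSystem

variable {E : Env}

/-! ### Projections -/

/-- `row (l, i)` becomes the projection of `row (l', i')` along `row (l'', i'')`. -/
def proj (l i l' i' l'' i'' : IX) : Prog :=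
  .seq (dot 0 l' i' l'' i'') (.seq (dot 1 l'' i'' l'' i'')
    (.seq (setSc 0 (.sub (.k 0) (.div (.sc 0) (.sc 1)))) (axpy l i l' i' 0 l'' i'')))

theorem IX.ev_setSc (σ : St E) (s : ℕ) (v : ℝ) (e : IX) : e.ev (σ.setSc s v) = e.ev σ := by
  induction e <;> simp_all [IX.ev, St.setSc]

/-- The real registers serve as scratch space: `Q` has to hold whatever they contain afterwards. -/
theorem Exec.proj {l i l' i' l'' i'' : IX} {σ : St E} {Q : St E → Prop}
    (h : ∀ f, Q ({ σ with sc := f }.setRow (l.ev σ) (i.ev σ)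
      (projOff (σ.row (l'.ev σ) (i'.ev σ)) (σ.row (l''.ev σ) (i''.ev σ)))))
    (h1 : l'.comp.cost + l''.comp.cost + i'.comp.cost + i''.comp.cost ≤ 200 := by decide)
    (h2 : l''.comp.cost + l''.comp.cost + i''.comp.cost + i''.comp.cost ≤ 200 := by decide)
    (h3 : l.comp.cost + l'.comp.cost + l''.comp.cost + i.comp.cost + i'.comp.cost +
      i''.comp.cost ≤ 200 := by decide) :
    Exec (RealRAM.proj l i l' i' l'' i'') σ 4 Q := by
  refine Exec.cons (Exec.dot (hc := h1) rfl ?_)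
  refine Exec.cons (Exec.dot (hc := h2) rfl ?_)
  refine Exec.cons (Exec.setSc ?_)
  refine Exec.axpy (hc := h3)
    (v := projOff (σ.row (l'.ev σ) (i'.ev σ)) (σ.row (l''.ev σ) (i''.ev σ))) ?_ ?_
  · simp only [IX.ev_setSc]
    simp [St.setSc, RX.ev, projOff]
  · simp only [IX.ev_setSc]
    exact h _

/-! ### Solving a system of strict inequalities in one unknown -/

/-- The body of the loop of `interval`. -/
def intervalBody : Prog :=
  .seq (dot 0 (.k 0) (.k 0) (.reg 1) (.add (.reg 4) (.k 1)))
  (.seq (dot 1 (.k 0) (.k 1) (.reg 1) (.add (.reg 4) (.k 1)))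
  (.ite (BX.rle (.sc 1) (.k 0)).comp
    (.ite (BX.rle (.k 0) (.sc 1)).comp
      (.ite (BX.rle (.sc 0) (.k 0)).comp
        (.seq (setReg 5 (.k 1)) (.seq (setReg 6 (.k 1)) (.seq (setSc 2 (.k 0)) (setSc 3 (.k 0)))))
        .skip)
      (.seq (setSc 4 (.sub (.k 0) (.div (.sc 0) (.sc 1))))
        (.ite (BX.and (.ile (.k 1) (.reg 6)) (.rle (.sc 3) (.sc 4))).comp .skip
          (.seq (setSc 3 (.sc 4)) (setReg 6 (.k 1))))))
    (.seq (setSc 4 (.sub (.k 0) (.div (.sc 0) (.sc 1))))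
      (.ite (BX.and (.ile (.k 1) (.reg 5)) (.rle (.sc 4) (.sc 2))).comp .skip
        (.seq (setSc 2 (.sc 4)) (setReg 5 (.k 1)))))))

/-- The last step of `interval`. -/
def intervalEnd : Prog :=
  .ite (BX.and (.ile (.k 1) (.reg 5)) (.and (.ile (.k 1) (.reg 6)) (.rle (.sc 3) (.sc 2)))).comp
    (setReg 2 (.k 0))
    (axpy (.reg 1) (.k 0) (.k 0) (.k 0) 4 (.k 0) (.k 1))

/-- Compute a `t` with `0 < (x + t • y) ⬝ a j` for all `j < reg 3`, where `x` and `y` are the rows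
`(0, 0)` and `(0, 1)` and `a j` is the row `(reg 1, j + 1)`, and put `x + t • y` into the row
`(reg 1, 0)`; if there is none, clear the register `2`. The bounds for `t` are kept in the real
registers `2` and `3`, and the registers `5` and `6` tell whether they are present. -/
def interval : Prog :=
  .seq (setReg 5 (.k 0)) (.seq (setReg 6 (.k 0)) (.seq (forReg 4 (.reg 3) intervalBody)
  (.seq
    (.ite (BX.ile (.k 1) (.reg 6)).comp
      (.ite (BX.ile (.k 1) (.reg 5)).comp
        (setSc 4 (.div (.add (.sc 2) (.sc 3)) (.k 2)))
        (setSc 4 (.sub (.sc 3) (.k 1))))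
      (.ite (BX.ile (.k 1) (.reg 5)).comp
        (setSc 4 (.add (.sc 2) (.k 1)))
        (setSc 4 (.k 0))))
    intervalEnd)))

/-- The integer arrays and the registers below `3` agree. -/
structure SameInt (σ σ' : St E) : Prop where
  reg : ∀ r < 3, σ'.reg r = σ.reg r
  idx : σ'.idx = σ.idx
  flag : σ'.flag = σ.flag

/-- The registers `5`, `6` and the real registers `2`, `3` describe the set of the solutions `t` of
the first `k` inequalities. -/
structure IntervalInv (σ : St E) (k : ℕ) (σ' : St E) : Prop where
  same : SameInt σ σ'
  cnt : σ'.reg 3 = σ.reg 3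
  row : σ'.row = σ.row
  iff : ∀ t : ℝ, (∀ j < k, 0 < σ.row 0 0 ⬝ᵥ σ.row (σ.reg 1) (j + 1) +
    t * (σ.row 0 1 ⬝ᵥ σ.row (σ.reg 1) (j + 1))) ↔
      (σ'.reg 5 = 0 ∨ σ'.sc 2 < t) ∧ (σ'.reg 6 = 0 ∨ t < σ'.sc 3)

theorem pos_iff_of_pos {α β t : ℝ} (h : 0 < β) : 0 < α + t * β ↔ 0 - α / β < t := by
  rw [zero_sub, ← neg_div, div_lt_iff₀ h]
  constructor <;> intro <;> linarith

theorem pos_iff_of_neg {α β t : ℝ} (h : β < 0) : 0 < α + t * β ↔ t < 0 - α / β := by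
  rw [zero_sub, ← neg_div, lt_div_iff_of_neg h]
  constructor <;> intro <;> linarith

theorem IntervalInv.body {σ : St E} {k : ℕ} {σ' : St E} (h : IntervalInv σ k σ') :
    Exec intervalBody (σ'.setReg 4 k) 20 (fun σ'' => σ''.reg 4 = k ∧ IntervalInv σ (k + 1) σ'') := by
  obtain ⟨⟨hr, hi, hf⟩, hc, hrow, hiff⟩ := h
  have h1 : σ'.reg 1 = σ.reg 1 := hr 1 (by omega)
  set α := σ.row 0 0 ⬝ᵥ σ.row (σ.reg 1) (k + 1) with hα
  set β := σ.row 0 1 ⬝ᵥ σ.row (σ.reg 1) (k + 1) with hβ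
  -- In every branch it remains to compare the old bounds plus one inequality with the new bounds.
  have main : ∀ σ'' : St E, (∀ r < 5, σ''.reg r = if r = 4 then k else σ'.reg r) →
      σ''.idx = σ'.idx → σ''.flag = σ'.flag → σ''.row = σ'.row →
      (∀ t : ℝ, (((σ'.reg 5 = 0 ∨ σ'.sc 2 < t) ∧ (σ'.reg 6 = 0 ∨ t < σ'.sc 3)) ∧
        0 < α + t * β) ↔ (σ''.reg 5 = 0 ∨ σ''.sc 2 < t) ∧ (σ''.reg 6 = 0 ∨ t < σ''.sc 3)) →
      σ''.reg 4 = k ∧ IntervalInv σ (k + 1) σ'' := by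
    intro σ'' h4 hi' hf' hr' ht
    refine ⟨by simpa using h4 4 (by omega), ⟨fun r h3 => ?_, by rw [hi', hi], by rw [hf', hf]⟩, ?_,
      by rw [hr', hrow], fun t => ?_⟩
    · rw [h4 r (by omega), if_neg (by omega), hr r h3]
    · rw [h4 3 (by omega), if_neg (by omega), hc]
    · rw [Nat.forall_lt_succ_right, hiff t, ht t]
  refine Exec.cons (Exec.dot (v := α) (by simp [St.setReg, IX.ev, h1, hrow, hα]) ?_)
  refine Exec.cons (Exec.dot (v := β) (by simp [St.setReg, St.setSc, IX.ev, h1, hrow, hβ]) ?_)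
  set τ := ((σ'.setReg 4 k).setSc 0 α).setSc 1 β with hτ
  have s0 : τ.sc 0 = α := by simp [hτ, St.setSc]
  have s1 : τ.sc 1 = β := by simp [hτ, St.setSc]
  have s2 : τ.sc 2 = σ'.sc 2 := by simp [hτ, St.setSc, St.setReg]
  have s3 : τ.sc 3 = σ'.sc 3 := by simp [hτ, St.setSc, St.setReg]
  have hreg : ∀ r, τ.reg r = if r = 4 then k else σ'.reg r := by
    simp [hτ, St.setSc, St.setReg, Function.update_apply]
  have hτi : τ.idx = σ'.idx := rfl
  have hτf : τ.flag = σ'.flag := rfl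
  have hτr : τ.row = σ'.row := rfl
  clear_value τ
  refine Exec.ite 12 5 (fun hle => ?_) (fun hlt => ?_)
  · refine Exec.ite 6 5 (fun hge => ?_) (fun hlt => ?_)
    · have hβ0 : β = 0 := by
        simp only [BX.ev, RX.ev, s1, Int.cast_zero] at hle hge
        linarith
      refine Exec.ite 4 1 (fun hα0 => ?_) (fun hα0 => ?_)
      · simp only [BX.ev, RX.ev, s0, Int.cast_zero] at hα0
        -- An inequality `0 < α` that fails for all `t` is recorded as the empty interval `0 < t <
        -- 0`.
        refine Exec.cons (Exec.setReg (Exec.cons (Exec.setReg (Exec.cons (Exec.setSc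
          (Exec.setSc ?_))))))
        refine main _ (fun r h5 => ?_) hτi hτf hτr (fun t => ?_)
        · simp [St.setReg, St.setSc, hreg, show ¬ r = 5 by omega, show ¬ r = 6 by omega]
        · simp only [St.setReg, St.setSc, Function.update_apply, IX.ev, RX.ev, hβ0, mul_zero,
            add_zero, Int.cast_zero]
          simp only [one_ne_zero, if_true, if_false, Nat.reduceEqDiff, false_or]
          constructor
          · rintro ⟨-, h⟩; linarith
          · rintro ⟨h, h'⟩; linarith
      · simp only [BX.ev, RX.ev, s0, Int.cast_zero] at hα0
        refine Exec.skip (main _ (fun r h5 => hreg r) hτi hτf hτr (fun t => ?_))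
        have : 0 < α := by linarith
        simp [hreg, s2, s3, hβ0, this]
    · have hβ0 : β < 0 := by
        simp only [BX.ev, RX.ev, s1, Int.cast_zero] at hlt
        linarith
      refine Exec.cons (Exec.setSc ?_)
      refine Exec.ite 1 2 (fun hb => ?_) (fun hb => ?_)
      · simp [BX.ev, RX.ev, IX.ev, s0, s1, s3, St.setSc, hreg] at hb
        refine Exec.skip (main _ (fun r h5 => hreg r) hτi hτf hτr (fun t => ?_))
        rw [pos_iff_of_neg hβ0]
        simp [hreg, s2, s3, St.setSc, show ¬ σ'.reg 6 = 0 by omega]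
        intro _ h; linarith
      · simp [BX.ev, RX.ev, IX.ev, s0, s1, s3, St.setSc, hreg] at hb
        refine Exec.cons (Exec.setSc (Exec.setReg ?_))
        refine main _ (fun r h5 => ?_) hτi hτf hτr (fun t => ?_)
        · simp [St.setReg, St.setSc, hreg, show ¬ r = 6 by omega]
        · rw [pos_iff_of_neg hβ0]
          simp [hreg, s0, s1, s2, St.setSc, St.setReg, RX.ev, IX.ev]
          rcases Nat.eq_zero_or_pos (σ'.reg 6) with h6 | h6
          · simp [h6]
          · have := hb h6
            simp [show ¬ σ'.reg 6 = 0 by omega]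
            intro _ _; linarith
  · have hβ0 : 0 < β := by
      simp only [BX.ev, RX.ev, s1, Int.cast_zero] at hlt
      linarith
    refine Exec.cons (Exec.setSc ?_)
    refine Exec.ite 1 2 (fun hb => ?_) (fun hb => ?_)
    · simp [BX.ev, RX.ev, IX.ev, s0, s1, s2, St.setSc, hreg] at hb
      refine Exec.skip (main _ (fun r h5 => hreg r) hτi hτf hτr (fun t => ?_))
      rw [pos_iff_of_pos hβ0]
      simp [hreg, s2, s3, St.setSc, show ¬ σ'.reg 5 = 0 by omega]
      intro h _; linarith
    · simp [BX.ev, RX.ev, IX.ev, s0, s1, s2, St.setSc, hreg] at hb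
      refine Exec.cons (Exec.setSc (Exec.setReg ?_))
      refine main _ (fun r h5 => ?_) hτi hτf hτr (fun t => ?_)
      · simp [St.setReg, St.setSc, hreg, show ¬ r = 5 by omega]
      · rw [pos_iff_of_pos hβ0]
        simp [hreg, s0, s1, s3, St.setSc, St.setReg, RX.ev, IX.ev]
        rcases Nat.eq_zero_or_pos (σ'.reg 5) with h6 | h6
        · simp [h6, and_comm]
        · have := hb h6
          simp [show ¬ σ'.reg 5 = 0 by omega]
          constructor
          · rintro ⟨⟨-, h⟩, h'⟩; exact ⟨h', h⟩
          · rintro ⟨h, h'⟩; exact ⟨⟨by linarith, h'⟩, h⟩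

theorem Exec.interval {σ : St E} {Q : St E → Prop}
    (hfail : ∀ σ' : St E, σ'.reg 0 = σ.reg 0 → σ'.reg 2 = 0 → σ'.flag = σ.flag →
      (¬ ∃ t : ℝ, ∀ j < σ.reg 3, 0 < σ.row 0 0 ⬝ᵥ σ.row (σ.reg 1) (j + 1) +
        t * (σ.row 0 1 ⬝ᵥ σ.row (σ.reg 1) (j + 1))) → Q σ')
    (hok : ∀ (σ' : St E) (w : Fin E.D → ℝ), SameInt σ σ' →
      σ'.row = Function.update σ.row (σ.reg 1) (Function.update (σ.row (σ.reg 1)) 0 w) →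
      (∀ j < σ.reg 3, 0 < w ⬝ᵥ σ.row (σ.reg 1) (j + 1)) → Q σ') :
    Exec RealRAM.interval σ (30 * (σ.reg 3 + 1)) Q := by
  refine Exec.mono (q := (σ.reg 3 * (20 + 1) + 1 + 11) + 1 + 1) ?_ (by omega) (fun _ h => h)
  refine Exec.cons (Exec.setReg (Exec.cons (Exec.setReg (Exec.seq (q := σ.reg 3 * (20 + 1) + 1)
    (r := 11) ?_))))
  refine Exec.forReg (σ := (σ.setReg 5 0).setReg 6 0) (e := .reg 3) (m := σ.reg 3) (q := 20) (IntervalInv σ)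
    (hm := fun k σ' _ h => by simpa [IX.ev, St.setReg] using h.cnt)
    (h0 := ⟨⟨fun r h3 => ?_, rfl, rfl⟩, ?_, rfl, fun t => ?_⟩)
    (hc := fun k σ' _ h => h.body) (hQ := fun σ' h => ?_)
  · simp [St.setReg, show ¬ r = 5 by omega, show ¬ r = 6 by omega]
  · simp [St.setReg]
  · simp [St.setReg]
  obtain ⟨⟨hr, hi, hf⟩, hc, hrow, hiff⟩ := h
  set τ := σ'.setReg 4 (σ.reg 3) with hτ
  have hreg : ∀ r, r ≠ 4 → τ.reg r = σ'.reg r := fun r h => by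
    simp [hτ, St.setReg, h]
  -- Either the interval is empty, and then the candidate `v` is irrelevant, or `v` lies in it. The
  -- candidate is the midpoint, a bound shifted by one, or `0`, according to which bounds are
  -- present.
  have main : ∀ v : ℝ, ((τ.reg 5 ≠ 0 ∧ τ.reg 6 ≠ 0 ∧ τ.sc 3 ≤ τ.sc 2) ∨
      ((τ.reg 5 = 0 ∨ τ.sc 2 < v) ∧ (τ.reg 6 = 0 ∨ v < τ.sc 3))) →
      Exec intervalEnd (τ.setSc 4 v) 3 Q := by
    intro v hv
    refine Exec.ite 1 1 (fun hb => ?_) (fun hb => ?_)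
    · refine Exec.setReg (hfail _ ?_ (by simp [St.setReg, IX.ev]) hf ?_)
      · simpa [St.setReg, St.setSc, hτ] using hr 0 (by omega)
      · rintro ⟨t, ht⟩
        have := (hiff t).1 ht
        simp [BX.ev, RX.ev, IX.ev, hτ, St.setSc, St.setReg] at hb
        obtain ⟨h5, h6, h7⟩ := hb
        rcases this with ⟨h8 | h8, h9 | h9⟩
        · omega
        · omega
        · omega
        · linarith
    · have hv' : (σ'.reg 5 = 0 ∨ σ'.sc 2 < v) ∧ (σ'.reg 6 = 0 ∨ v < σ'.sc 3) := by
        rcases hv with ⟨h5, h6, h7⟩ | hv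
        · refine absurd ?_ hb
          simp [BX.ev, RX.ev, IX.ev, St.setSc]
          exact ⟨by omega, by omega, h7⟩
        · simpa [hτ, St.setReg] using hv
      have h1 : τ.reg 1 = σ.reg 1 := by rw [hreg 1 (by omega), hr 1 (by omega)]
      refine Exec.axpy rfl (hok _ (σ.row 0 0 + v • σ.row 0 1) ⟨fun r h3 => ?_, hi, hf⟩ ?_ fun j hj => ?_)
      · simpa [St.setRow, St.setSc, hreg r (by omega)] using hr r h3
      · have hτr : τ.row = σ.row := hrow
        simp [St.setRow, St.setSc, IX.ev, h1, hτr]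
      · have := (hiff v).2 hv' j hj
        simpa [add_dotProduct, smul_dotProduct] using this
  clear_value τ
  refine Exec.seq (q := 7 + 1) (r := 3) ?_
  refine Exec.ite 4 3 (fun h6 => ?_) (fun h6 => ?_)
  · simp only [BX.ev, IX.ev] at h6
    refine Exec.mono (q := 3) (Exec.ite 1 1 (fun h5 => ?_) (fun h5 => ?_)) (by omega) (fun _ h => h)
    · simp only [BX.ev, IX.ev] at h5
      refine Exec.setSc (main _ ?_)
      simp only [RX.ev]
      rcases le_or_gt (τ.sc 3) (τ.sc 2) with h | h
      · exact Or.inl ⟨by omega, by omega, h⟩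
      · exact Or.inr ⟨Or.inr (by push_cast; linarith), Or.inr (by push_cast; linarith)⟩
    · simp only [BX.ev, IX.ev] at h5
      refine Exec.setSc (main _ (Or.inr ⟨Or.inl (by omega), Or.inr ?_⟩))
      simp [RX.ev]
  · simp only [BX.ev, IX.ev] at h6
    refine Exec.ite 1 1 (fun h5 => ?_) (fun h5 => ?_)
    · simp only [BX.ev, IX.ev] at h5
      refine Exec.setSc (main _ (Or.inr ⟨Or.inr ?_, Or.inl (by omega)⟩))
      simp [RX.ev]
    · simp only [BX.ev, IX.ev] at h5
      exact Exec.setSc (main _ (Or.inr ⟨Or.inl (by omega), Or.inl (by omega)⟩))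

end RealRAM

namespace RealRAM

open StrictSystem

variable {E : Env}

/-! ### Systems in a plane -/

/-- The body of the loop of `plane`. -/
def planeBody : Prog :=
  .seq (dot 0 (.k 0) (.k 1) (.k 0) (.k 1))
    (.ite (BX.rle (.sc 0) (.k 0)).comp
      (proj (.k 0) (.k 1) (.reg 1) (.add (.reg 4) (.k 1)) (.k 0) (.k 0)) .skip)

/-- The part of `plane` for a first constraint that is not zero. -/
def planeMain : Prog :=
  .seq (setSc 0 (.k 0))
  (.seq (axpy (.k 0) (.k 0) (.reg 1) (.k 1) 0 (.reg 1) (.k 1))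
  (.seq (setSc 0 (.k (-1)))
  (.seq (axpy (.k 0) (.k 1) (.k 0) (.k 1) 0 (.k 0) (.k 1))
  (.seq (setIdx (.reg 1) (.reg 3))
  (.seq (forReg 4 (.reg 3) planeBody) interval)))))

/-- Solve the system of the level `reg 1` if its constraints span at most a plane. -/
def plane : Prog :=
  .seq (setReg 3 (.idx (.add (.reg 1) (.k 1))))
  (.seq (dot 0 (.reg 1) (.k 1) (.reg 1) (.k 1))
  (.ite (BX.rle (.sc 0) (.k 0)).comp (setReg 2 (.k 0)) planeMain))

/-- With `x` the first constraint and `y` the first nonzero projection of a constraint along `x`,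
all constraints are combinations of `x` and `y`, and `Feas.exists_line` reduces the system to one
unknown. A zero first constraint makes it unsolvable. -/
theorem Exec.plane {σ : St E} {l m : ℕ} {V : Submodule ℝ (Fin E.D → ℝ)} {Q : St E → Prop}
    (hl : σ.reg 1 = l) (hl1 : 1 ≤ l) (hm : σ.idx (l + 1) = m) (hm0 : 0 < m)
    (hV : Module.finrank ℝ V ≤ 2) (hmem : ∀ j < m, σ.row l (j + 1) ∈ V)
    (hfail : ∀ σ' : St E, σ'.reg 0 = σ.reg 0 → σ'.reg 2 = 0 → σ'.flag = σ.flag →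
      ¬ Feas (fun j => σ.row l (j + 1)) m → Q σ')
    (hok : ∀ σ' : St E, (∀ r < 3, σ'.reg r = σ.reg r) → σ'.flag = σ.flag →
      σ'.idx = Function.update σ.idx l m → (∀ l' i, 1 ≤ l' → l' ≠ l ∨ i ≠ 0 →
      σ'.row l' i = σ.row l' i) → (∀ j < m, 0 < σ'.row l 0 ⬝ᵥ σ.row l (j + 1)) → Q σ') :
    Exec RealRAM.plane σ (50 * (m + 1)) Q := by
  refine Exec.mono (q := (1 + (m * (7 + 1) + 1 + 30 * (m + 1) + 1 + 1 + 1 + 1 + 1) + 1) + 1 + 1)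
    ?_ (by omega) (fun _ h => h)
  refine Exec.cons (Exec.setReg (Exec.cons (Exec.dot rfl (Exec.ite _ _ (fun h0 => ?_)
    (fun h0 => ?_)))))
  · refine Exec.setReg (hfail _ (by simp [St.setReg, St.setSc]) (by simp [St.setReg, IX.ev]) rfl ?_)
    rintro ⟨w, hw⟩
    have h1 : σ.row l 1 = 0 := by
      by_contra h1
      have := dot_self_pos h1
      simp [BX.ev, RX.ev, IX.ev, St.setSc, St.setReg, hl] at h0
      linarith
    have := hw 0 hm0
    simp [h1] at this
  have h1 : σ.row l 1 ≠ 0 := by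
    intro h1
    simp [BX.ev, RX.ev, IX.ev, St.setSc, St.setReg, hl, h1] at h0
  refine Exec.cons (Exec.setSc (Exec.cons (Exec.axpy (v := σ.row l 1) ?_ (Exec.cons (Exec.setSc
    (Exec.cons (Exec.axpy (v := 0) ?_ (Exec.cons (Exec.setIdx
    (Exec.seq (q := m * (7 + 1) + 1) (r := 30 * (m + 1)) ?_))))))))))
  · simp [St.setReg, St.setSc, IX.ev, RX.ev, hl]
  · simp [St.setReg, St.setSc, St.setRow, IX.ev, RX.ev]
  refine Exec.forReg (e := .reg 3) (m := m) (q := 7)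
    -- The row `(0, 1)` holds `y`. As long as it is zero, all projections met so far vanish; once
    -- nonzero it is kept.
    (fun k σ' => σ'.reg 3 = m ∧ (∀ r < 3, σ'.reg r = σ.reg r) ∧ σ'.flag = σ.flag ∧
      σ'.idx = Function.update σ.idx l m ∧ (∀ l' i, 1 ≤ l' → σ'.row l' i = σ.row l' i) ∧
      σ'.row 0 0 = σ.row l 1 ∧ σ'.row 0 1 ∈ V ⊓ orth (σ.row l 1) ∧
      (σ'.row 0 1 = 0 → ∀ j < k, projOff (σ.row l (j + 1)) (σ.row l 1) = 0))
    (hm := fun k σ' _ h => by simpa [IX.ev, St.setReg] using h.1) (h0 := ?_) (hc := ?_) (hQ := ?_)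
  · refine ⟨?_, fun r hr => ?_, rfl, ?_, fun l' i hl' => ?_, ?_, ?_, fun _ j hj => ?_⟩
    · simp [St.setReg, St.setSc, St.setRow, St.setIdx, IX.ev, hl, hm]
    · simp [St.setReg, St.setSc, St.setRow, St.setIdx, show ¬ r = 3 by omega]
    · simp [St.setReg, St.setSc, St.setRow, St.setIdx, IX.ev, hl, hm]
    · simp [St.setReg, St.setSc, St.setRow, St.setIdx, IX.ev, show ¬ l' = 0 by omega]
    · simp [St.setReg, St.setSc, St.setRow, St.setIdx, IX.ev]
    · simp [St.setReg, St.setSc, St.setRow, St.setIdx, IX.ev]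
    · omega
  · rintro k σ' hk ⟨g3, gr, gf, gi, grow, g0, gy, gz⟩
    have g1 : σ'.reg 1 = l := by rw [gr 1 (by omega), hl]
    refine Exec.cons (Exec.dot rfl (Exec.ite 4 1 (fun hy => ?_) (fun hy => ?_)))
    · have hy0 : σ'.row 0 1 = 0 := by
        by_contra h
        have := dot_self_pos h
        simp [BX.ev, RX.ev, IX.ev, St.setSc, St.setReg] at hy
        linarith
      refine Exec.proj fun f => ?_
      have hv : projOff (σ'.row l (k + 1)) (σ'.row 0 0) =
          projOff (σ.row l (k + 1)) (σ.row l 1) := by rw [grow _ _ hl1, g0]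
      simp only [St.setReg, St.setSc, St.setRow, IX.ev, g1, Function.update_self,
        Function.update_of_ne (show (1 : ℕ) ≠ 4 by decide), hv]
      refine ⟨trivial, ?_, fun r hr => ?_, gf, gi, fun l' i hl' => ?_, ?_, ?_, fun hz j hj => ?_⟩
      · simpa using g3
      · simpa [show ¬ r = 4 by omega] using gr r hr
      · simpa [show ¬ l' = 0 by omega] using grow l' i hl'
      · simpa using g0
      · simpa using projOff_mem h1 (hmem 0 hm0) (hmem k hk)
      · rcases Nat.lt_succ_iff_lt_or_eq.1 hj with hj | rfl
        · exact gz hy0 j hj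
        · exact hz
    · refine Exec.skip ⟨by simp [St.setReg, St.setSc], by simpa [St.setReg, St.setSc] using g3,
        fun r hr => ?_, gf, gi, grow, g0, gy, fun hz => ?_⟩
      · simpa [St.setReg, St.setSc, show ¬ r = 4 by omega] using gr r hr
      · have hz' : σ'.row 0 1 = 0 := hz
        simp [BX.ev, RX.ev, IX.ev, St.setSc, St.setReg, hz'] at hy
  · rintro σ' ⟨g3, gr, gf, gi, grow, g0, gy, gz⟩
    have g1 : σ'.reg 1 = l := by rw [gr 1 (by omega), hl]
    have e3 : (σ'.setReg 4 m).reg 3 = m := by simpa [St.setReg] using g3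
    have e1 : (σ'.setReg 4 m).reg 1 = l := by simpa [St.setReg] using g1
    have er : (σ'.setReg 4 m).row = σ'.row := rfl
    have hint := Exec.interval (σ := σ'.setReg 4 m) (Q := Q)
    rw [e3, e1, er] at hint
    refine hint (fun σ'' k0 k2 kf hno => ?_) (fun σ'' w ks krow kw => ?_)
    · refine hfail σ'' ?_ k2 (kf.trans gf) fun hF => hno ?_
      · rw [k0]; simpa [St.setReg] using gr 0 (by omega)
      -- The part of `V` orthogonal to `x` has dimension at most one, so every projection is a
      -- multiple of `y`, unless `y` and all projections are zero.
      · obtain ⟨t, ht⟩ := hF.exists_line (x := σ.row l 1) (y := σ'.row 0 1) (fun _ => rfl) gy.2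
          (fun j hj => by
            by_cases hy0 : σ'.row 0 1 = 0
            · exact ⟨0, by rw [gz hy0 j hj, zero_smul]⟩
            · exact exists_smul_eq_of_finrank (finrank_inf_orth hV h1 (hmem 0 hm0)) hy0 gy
                (projOff_mem h1 (hmem 0 hm0) (hmem j hj)))
        refine ⟨t, fun j hj => ?_⟩
        rw [g0, grow _ _ hl1]
        exact ht j hj
    · refine hok σ'' (fun r hr => ?_) (ks.flag.trans gf) (ks.idx.trans gi)
        (fun l' i hl' hne => ?_) (fun j hj => ?_)
      · rw [ks.reg r hr]
        simpa [St.setReg, show ¬ r = 4 by omega] using gr r hr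
      · rw [krow, ← grow l' i hl']
        by_cases hll : l' = l
        · subst hll
          rw [Function.update_self, Function.update_of_ne (by tauto)]
        · rw [Function.update_of_ne hll]
      · have := kw j hj
        rw [grow _ _ hl1] at this
        simpa [krow] using this

/-! ### Changing the level -/

/-- Go up one level: turn the solution of the projected system into one of the constraints up to
the one along which they have been projected. -/
def lift : Prog :=
  .seq (setReg 1 (.add (.reg 1) (.k 1)))
  (.seq (proj (.k 0) (.k 0) (.sub (.reg 1) (.k 1)) (.k 0) (.reg 1) (.add (.idx (.reg 1)) (.k 1)))
  (.seq (setSc 0 (.k 0))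
  (.seq (axpy (.k 0) (.k 1) (.reg 1) (.add (.idx (.reg 1)) (.k 1)) 0
    (.reg 1) (.add (.idx (.reg 1)) (.k 1)))
  (.seq (setIdx (.reg 1) (.add (.idx (.reg 1)) (.k 1)))
  (.seq (setReg 3 (.idx (.reg 1))) interval)))))

theorem Exec.lift {σ : St E} {l i : ℕ} {Q : St E → Prop} (hl : σ.reg 1 = l) (hl1 : 1 ≤ l)
    (hi : σ.idx (l + 1) = i) (ha : σ.row (l + 1) (i + 1) ≠ 0)
    (hw : ∀ j < i, 0 < σ.row l 0 ⬝ᵥ projOff (σ.row (l + 1) (j + 1)) (σ.row (l + 1) (i + 1)))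
    (hok : ∀ σ' : St E, σ'.reg 0 = σ.reg 0 → σ'.reg 1 = l + 1 → σ'.reg 2 = σ.reg 2 →
      σ'.flag = σ.flag → σ'.idx = Function.update σ.idx (l + 1) (i + 1) →
      (∀ l' i, l < l' → l' ≠ l + 1 ∨ i ≠ 0 → σ'.row l' i = σ.row l' i) →
      (∀ j < i + 1, 0 < σ'.row (l + 1) 0 ⬝ᵥ σ.row (l + 1) (j + 1)) → Q σ') :
    Exec RealRAM.lift σ (50 * (i + 2)) Q := by
  refine Exec.mono (q := (4 + (30 * (i + 2) + 1 + 1 + 1 + 1)) + 1) ?_ (by omega) (fun _ h => h)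
  have hl' : l ≠ l + 1 := by omega
  refine Exec.cons (Exec.setReg (Exec.seq (q := 4) (r := 30 * (i + 2) + 1 + 1 + 1 + 1)
    (Exec.proj fun f => Exec.cons (Exec.setSc
    (Exec.cons (Exec.axpy (v := σ.row (l + 1) (i + 1)) ?_ (Exec.cons (Exec.setIdx (Exec.cons
    (Exec.setReg ?_))))))))))
  · simp [St.setReg, St.setSc, St.setRow, IX.ev, RX.ev, hl, hi]
  set τ : St E := St.setReg (St.setIdx _ _ _) _ _ with hτ
  have e0 : τ.reg 0 = σ.reg 0 := by simp [hτ, St.setReg, St.setSc, St.setRow, St.setIdx]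
  have e1 : τ.reg 1 = l + 1 := by simp [hτ, St.setReg, St.setSc, St.setRow, St.setIdx, IX.ev, hl]
  have e2 : τ.reg 2 = σ.reg 2 := by simp [hτ, St.setReg, St.setSc, St.setRow, St.setIdx]
  have e3 : τ.reg 3 = i + 1 := by
    simp [hτ, St.setReg, St.setSc, St.setRow, St.setIdx, IX.ev, hl, hi]
  have ef : τ.flag = σ.flag := rfl
  have ei : τ.idx = Function.update σ.idx (l + 1) (i + 1) := by
    simp [hτ, St.setReg, St.setSc, St.setRow, St.setIdx, IX.ev, hl, hi]
  have er : ∀ l' i, 1 ≤ l' → τ.row l' i = σ.row l' i := by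
    intro l' i hl'
    simp [hτ, St.setReg, St.setSc, St.setRow, St.setIdx, IX.ev, show ¬ l' = 0 by omega]
  have er0 : τ.row 0 0 = projOff (σ.row l 0) (σ.row (l + 1) (i + 1)) := by
    simp [hτ, St.setReg, St.setSc, St.setRow, St.setIdx, IX.ev, hl, hi]
  have er1 : τ.row 0 1 = σ.row (l + 1) (i + 1) := by
    simp [hτ, St.setReg, St.setSc, St.setRow, St.setIdx, IX.ev]
  clear_value τ
  have hint := Exec.interval (σ := τ) (Q := Q)
  rw [e3, e1, er0, er1] at hint
  -- The search on the line cannot fail, by `exists_lift`.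
  refine hint (fun σ'' k0 k2 kf hno => absurd ?_ hno) (fun σ'' w ks krow kw => ?_)
  · obtain ⟨t, ht⟩ := exists_lift (a := fun j => σ.row (l + 1) (j + 1)) ha hw
    refine ⟨t, fun j hj => ?_⟩
    rw [er _ _ (by omega)]
    exact ht j hj
  · refine hok σ'' ?_ ?_ ?_ (ks.flag.trans ef) (ks.idx.trans ei) (fun l' i hl' hne => ?_)
      (fun j hj => ?_)
    · rw [ks.reg 0 (by omega), e0]
    · rw [ks.reg 1 (by omega), e1]
    · rw [ks.reg 2 (by omega), e2]
    · rw [krow, ← er l' i (by omega)]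
      by_cases hll : l' = l + 1
      · subst hll
        rw [Function.update_self, Function.update_of_ne (by tauto)]
      · rw [Function.update_of_ne hll]
    · have := kw j hj
      rw [er _ _ (by omega)] at this
      simpa [krow] using this

/-- Project the constraints before the current one along it, and go down one level. -/
def descend : Prog :=
  .seq (forReg 4 (.idx (.reg 1)) (proj (.sub (.reg 1) (.k 1)) (.add (.reg 4) (.k 1))
      (.reg 1) (.add (.reg 4) (.k 1)) (.reg 1) (.add (.idx (.reg 1)) (.k 1))))
  (.seq (setReg 1 (.sub (.reg 1) (.k 1))) (setIdx (.reg 1) (.k 0)))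

/-- Treat the current constraint of the current level. -/
def advance : Prog :=
  .seq (dot 0 (.reg 1) (.k 0) (.reg 1) (.add (.idx (.reg 1)) (.k 1)))
  (.ite (BX.rle (.sc 0) (.k 0)).comp
    (.seq (dot 0 (.reg 1) (.add (.idx (.reg 1)) (.k 1)) (.reg 1) (.add (.idx (.reg 1)) (.k 1)))
      (.ite (BX.rle (.sc 0) (.k 0)).comp (setReg 2 (.k 0)) descend))
    (setIdx (.reg 1) (.add (.idx (.reg 1)) (.k 1))))

/-- The constraints of the level `l` are the projections of the first `i` of the level `l + 1`, so
`idx (l + 1)` is at once the progress of its own level and the number of constraints of the level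
below. -/
theorem Exec.advance {σ : St E} {l i : ℕ} {Q : St E → Prop} (hl : σ.reg 1 = l + 1)
    (hi : σ.idx (l + 1) = i)
    (hpos : 0 < σ.row (l + 1) 0 ⬝ᵥ σ.row (l + 1) (i + 1) → ∀ σ' : St E, σ'.reg = σ.reg →
      σ'.flag = σ.flag → σ'.idx = Function.update σ.idx (l + 1) (i + 1) → σ'.row = σ.row → Q σ')
    (hzero : σ.row (l + 1) (i + 1) = 0 → ∀ σ' : St E, σ'.reg 0 = σ.reg 0 → σ'.reg 2 = 0 →
      σ'.flag = σ.flag → Q σ')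
    (hdesc : ¬ 0 < σ.row (l + 1) 0 ⬝ᵥ σ.row (l + 1) (i + 1) → σ.row (l + 1) (i + 1) ≠ 0 →
      ∀ σ' : St E, σ'.reg 0 = σ.reg 0 → σ'.reg 1 = l → σ'.reg 2 = σ.reg 2 →
      σ'.flag = σ.flag → σ'.idx = Function.update σ.idx l 0 →
      (∀ l', l < l' → σ'.row l' = σ.row l') →
      (∀ j < i, σ'.row l (j + 1) = projOff (σ.row (l + 1) (j + 1)) (σ.row (l + 1) (i + 1))) →
      Q σ') : Exec RealRAM.advance σ (20 * (i + 1)) Q := by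
  refine Exec.mono (q := (1 + (i * (4 + 1) + 1 + 2) + 1 + 1) + 1 + 1 + 1)
    ?_ (by omega) (fun _ h => h)
  refine Exec.cons (Exec.dot (v := σ.row (l + 1) 0 ⬝ᵥ σ.row (l + 1) (i + 1))
    (by simp [IX.ev, hl, hi])
    (Exec.ite (1 + (i * (4 + 1) + 1 + 2) + 1 + 1) 1 (fun h => ?_) (fun h => ?_)))
  · simp [BX.ev, RX.ev, St.setSc] at h
    refine Exec.cons (Exec.dot (v := σ.row (l + 1) (i + 1) ⬝ᵥ σ.row (l + 1) (i + 1))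
      (by simp [IX.ev, hl, hi, St.setSc])
      (Exec.ite _ _ (fun h' => ?_) (fun h' => ?_)))
    · simp [BX.ev, RX.ev, St.setSc] at h'
      have h0 : σ.row (l + 1) (i + 1) = 0 := by
        by_contra h0
        exact absurd (dot_self_pos h0) (not_lt.2 h')
      exact Exec.setReg (hzero h0 _ (by simp [St.setReg, St.setSc]) (by simp [St.setReg, IX.ev]) rfl)
    · simp [BX.ev, RX.ev, St.setSc] at h'
      have h0 : σ.row (l + 1) (i + 1) ≠ 0 := by
        rintro h0
        simp [h0] at h'
      refine Exec.seq (q := i * (4 + 1) + 1) (r := 2) ?_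
      refine Exec.forReg (σ := St.setSc (St.setSc σ 0 _) 0 _) (e := .idx (.reg 1)) (m := i) (q := 4)
        (fun k σ' => (∀ r < 4, σ'.reg r = σ.reg r) ∧ σ'.flag = σ.flag ∧ σ'.idx = σ.idx ∧
          (∀ l', l < l' → σ'.row l' = σ.row l') ∧ ∀ j < k, σ'.row l (j + 1) =
            projOff (σ.row (l + 1) (j + 1)) (σ.row (l + 1) (i + 1)))
        (hm := fun k σ' _ h => ?_) (h0 := ⟨fun r _ => rfl, rfl, rfl, fun l' _ => rfl, by simp⟩)
        (hc := ?_) (hQ := ?_)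
      · obtain ⟨gr, gf, gi, -, -⟩ := h
        simp [IX.ev, St.setReg, gr, gi, hl, hi]
      · rintro k σ' hk ⟨gr, gf, gi, grow, gp⟩
        refine Exec.proj fun f => ?_
        simp only [St.setReg, St.setRow, IX.ev, gr 1 (by omega), Function.update_self,
          Function.update_of_ne (show (1 : ℕ) ≠ 4 by decide), hl, Nat.add_sub_cancel, gi, hi,
          grow (l + 1) (by omega)]
        refine ⟨trivial, fun r hr => ?_, gf, trivial, fun l' hl' => ?_, fun j hj => ?_⟩
        · rw [Function.update_of_ne (by omega), gr r hr]
        · rw [Function.update_of_ne (by omega), grow _ hl']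
        · rcases Nat.lt_succ_iff_lt_or_eq.1 hj with hj | rfl
          · simpa [show ¬ j = k by omega] using gp j hj
          · simp
      · rintro σ' ⟨gr, gf, gi, grow, gp⟩
        refine Exec.cons (Exec.setReg (Exec.setIdx (hdesc (not_lt.2 h) h0 _ ?_ ?_ ?_ gf ?_ grow gp)))
        · simp [St.setReg, St.setIdx, gr]
        · simp [St.setReg, St.setIdx, IX.ev, gr, hl]
        · simp [St.setReg, St.setIdx, gr]
        · simp [St.setReg, St.setIdx, IX.ev, gr, hl, gi]
  · simp [BX.ev, RX.ev, St.setSc] at h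
    refine Exec.setIdx (hpos h _ rfl rfl ?_ rfl)
    simp [St.setIdx, St.setSc, IX.ev, hl, hi]

/-! ### The main loop -/

/-- One step of the algorithm. -/
def solveStep : Prog :=
  .ite (BX.ile (.idx (.add (.reg 1) (.k 1))) (.idx (.reg 1))).comp
    (.ite (BX.ile .D (.reg 1)).comp (setReg 2 (.k 2)) lift)
    (.ite (BX.ile (.reg 1) (.k 2)).comp plane advance)

/-- Solve the system of the level `reg 1`: the register `2` is `1` as long as the algorithm is
running, and finally `2` or `0` according as there is a solution or not. -/
def solveLoop : Prog :=
  .loop (BX.and (.ile (.k 1) (.reg 2)) (.ile (.reg 2) (.k 1))).comp solveStep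

/-- A bound for the time to solve a system of `m` constraints on the level `d + 2`. -/
def solveTime : ℕ → ℕ → ℕ
  | 0, m => 200 * (m + 1)
  | d + 1, m => ∑ j ∈ Finset.range m, (solveTime d j + 200 * (j + 1))

/-- The content `σ'` is reached from `σ` when the first `i` constraints of the level `l` have been
treated. -/
structure Treated (l i : ℕ) (σ σ' : St E) : Prop where
  reg0 : σ'.reg 0 = σ.reg 0
  reg1 : σ'.reg 1 = l
  reg2 : σ'.reg 2 = 1
  flag : σ'.flag = σ.flag
  idx : σ'.idx l = i
  idx_above : ∀ l' > l, σ'.idx l' = σ.idx l'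
  row_above : ∀ l' > l, σ'.row l' = σ.row l'
  row : ∀ j, σ'.row l (j + 1) = σ.row l (j + 1)
  pos : ∀ j < i, 0 < σ'.row l 0 ⬝ᵥ σ.row l (j + 1)

theorem Exec.solveLoop_step {σ : St E} {q r : ℕ} {Q : St E → Prop} (h : σ.reg 2 = 1)
    (hs : Exec solveStep σ q (fun σ' => Exec solveLoop σ' r Q)) :
    Exec solveLoop σ (1 + q + r) Q :=
  Exec.loop_true (by simp [BX.ev, IX.ev, h]) hs

/-- Since programs have no procedures, one loop simulates the recursion, with the level in a
register and the array `idx` as the stack. Hence the continuation style: what the loop does after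
this level is finished or has failed is given by the last two hypotheses, at cost `q`. `Treated (d +
2) 0 σ σ` says nothing about the row `(d + 2, 0)`, so the initial candidate may be arbitrary. -/
theorem solve (d : ℕ) : ∀ (σ : St E) (m : ℕ) (V : Submodule ℝ (Fin E.D → ℝ)) (q : ℕ)
    (Q : St E → Prop), d + 2 ≤ E.D → Module.finrank ℝ V ≤ d + 2 → σ.idx (d + 3) = m →
    (∀ j < m, σ.row (d + 2) (j + 1) ∈ V) → Treated (d + 2) 0 σ σ →
    (∀ σ' : St E, σ'.reg 0 = σ.reg 0 → σ'.reg 2 = 0 → σ'.flag = σ.flag →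
      ¬ Feas (fun j => σ.row (d + 2) (j + 1)) m → Exec solveLoop σ' q Q) →
    (∀ σ', Treated (d + 2) m σ σ' → Exec solveLoop σ' q Q) →
    Exec solveLoop σ (solveTime d m + q) Q := by
  induction d with
  | zero =>
    intro σ m V q Q hD hV hm hmem h0 hfail hok
    rcases Nat.eq_zero_or_pos m with rfl | hm0
    -- Without constraints the level is already finished; the loop would not even enter `plane`.
    · exact (hok σ h0).mono (by omega) (fun _ h => h)
    refine Exec.mono (q := 1 + (_ + (1 + 50 * (m + 1) + 1) + 1) + q) (Exec.solveLoop_step h0.reg2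
      (Exec.ite 1 (1 + 50 * (m + 1) + 1) (fun h => ?_)
      (fun _ => Exec.mono (q := 50 * (m + 1) + 1 + 1) (Exec.ite (50 * (m + 1)) 1
        (fun _ => Exec.plane h0.reg1 (by omega) hm hm0 hV hmem hfail fun σ' gr gf gi grow gw =>
          hok σ' ⟨gr 0 (by omega), (gr 1 (by omega)).trans h0.reg1, (gr 2 (by omega)).trans h0.reg2,
            gf, by simp [gi], fun l' hl' => by rw [gi, Function.update_of_ne (by omega)],
            fun l' hl' => funext fun i => grow l' i (by omega) (Or.inl (by omega)),
            fun j => grow _ _ (by omega) (Or.inr (by omega)), gw⟩)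
        (fun h => absurd (by simp [BX.ev, IX.ev, h0.reg1]) h)) (by omega) (fun _ h => h))))
      (by simp only [solveTime]; omega) (fun _ h => h)
    simp only [BX.ev, IX.ev, h0.reg1] at h
    have h' : σ.idx 3 ≤ σ.idx 2 := h
    have h2 : σ.idx 2 = 0 := h0.idx
    have h3 : σ.idx 3 = m := hm
    omega
  | succ d ih =>
    intro σ m V q Q hD hV hm hmem h0 hfail hok
    -- Inner induction on the number `k` of constraints still to be treated; the sum from `i` on is
    -- the remaining time.
    have main : ∀ k i σ', i + k = m → Treated (d + 3) i σ σ' →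
        Exec solveLoop σ' (∑ j ∈ Finset.Ico i m, (solveTime d j + 200 * (j + 1)) + q) Q := by
      intro k
      induction k with
      | zero =>
        intro i σ' hi h
        obtain rfl : i = m := by omega
        simpa using hok σ' h
      | succ k ihk =>
        intro i σ' hi h
        have him : i < m := by omega
        have hidx : σ'.idx (d + 3) = i := h.idx
        have hcons : ∀ j, σ'.row (d + 3) (j + 1) = σ.row (d + 3) (j + 1) := h.row
        rw [Finset.sum_eq_sum_Ico_succ_bot him]
        refine Exec.mono (q := 1 + (1 + (1 + 20 * (i + 1) + 1) + 1) + (solveTime d i +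
          (1 + (1 + 50 * (i + 2) + 1 + 1 + 1) +
          (∑ j ∈ Finset.Ico (i + 1) m, (solveTime d j + 200 * (j + 1)) + q))))
          (Exec.solveLoop_step h.reg2 (Exec.ite 1 (1 + 20 * (i + 1) + 1) (fun hge => ?_)
            (fun _ => Exec.ite 1 (20 * (i + 1)) (fun hlt => ?_) (fun _ =>
              Exec.advance (l := d + 2) h.reg1 h.idx (fun hp σ'' gr gf gi grow => ?_)
                (fun hz σ'' g0 g2 gf => ?_)
                (fun hn hnz σ'' g0 g1 g2 gf gi grow gp => ?_))))) (by omega) (fun _ h => h)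
        · have := h.idx_above (d + 4) (by omega)
          have hm' : σ.idx (d + 4) = m := hm
          simp only [BX.ev, IX.ev, h.reg1] at hge
          have hge' : σ'.idx (d + 4) ≤ σ'.idx (d + 3) := hge
          omega
        · simp only [BX.ev, IX.ev, h.reg1] at hlt
          omega
        · refine Exec.mono (ihk (i + 1) σ'' (by omega) ⟨by rw [gr, h.reg0], by rw [gr, h.reg1],
            by rw [gr, h.reg2], gf.trans h.flag, by simp [gi], fun l' hl' => ?_,
            fun l' hl' => by rw [grow, h.row_above l' hl'], fun j => by rw [grow, h.row],
            fun j hj => ?_⟩) (by omega) (fun _ h => h)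
          · rw [gi, Function.update_of_ne (by omega), h.idx_above l' hl']
          · rw [grow]
            rcases Nat.lt_succ_iff_lt_or_eq.1 hj with hj | rfl
            · exact h.pos j hj
            · rw [← h.row]; exact hp
        · refine Exec.mono (hfail σ'' (g0.trans h.reg0) g2 (gf.trans h.flag) ?_) (by omega)
            (fun _ h => h)
          rintro ⟨w, hw⟩
          have := hw i him
          have hz' : σ.row (d + 3) (i + 1) = 0 := by rw [← hcons]; exact hz
          simp [hz'] at this
        · have ha : σ.row (d + 3) (i + 1) ≠ 0 := by rw [← hcons]; exact hnz
          have hproj : ∀ j < i, σ''.row (d + 2) (j + 1) =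
              projOff (σ.row (d + 3) (j + 1)) (σ.row (d + 3) (i + 1)) := fun j hj => by
            rw [gp j hj, hcons, hcons]
          -- The violated constraint is not zero: the `i` projected constraints lie in a space of
          -- smaller dimension. The continuation in case of success is `lift` followed by the rest
          -- of this level.
          refine ih σ'' i (V ⊓ orth (σ.row (d + 3) (i + 1))) _ Q (by omega)
            (finrank_inf_orth hV ha (hmem i him)) ?_ (fun j hj => ?_)
            ⟨rfl, g1, g2.trans h.reg2, rfl, by simp [gi], fun _ _ => rfl, fun _ _ => rfl,
              fun _ => rfl, by simp⟩ (fun σ₃ k0 k2 kf hno => ?_) (fun σ₃ h₃ => ?_)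
          · rw [gi, Function.update_of_ne (by omega), hidx]
          · rw [hproj j hj]
            exact projOff_mem ha (hmem i him) (hmem j (by omega))
          · refine Exec.mono (hfail σ₃ (k0.trans (g0.trans h.reg0)) k2
              (kf.trans (gf.trans h.flag)) fun hF => hno ?_) (by omega) (fun _ h => h)
            -- If the projected system is unsolvable, so are the first `i + 1` constraints and hence
            -- the whole system; therefore failure ends all levels at once.
            obtain ⟨w, hw⟩ := Feas.descend (hF.mono (Nat.succ_le_of_lt him)) (w := σ'.row (d + 3) 0)
              (fun j hj => h.pos j hj) (by rw [← hcons]; exact hn)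
            exact ⟨w, fun j hj => by simpa only [hproj j hj] using hw j hj⟩
          · have i3 : σ₃.idx (d + 3) = i := by
              rw [h₃.idx_above _ (by omega), gi, Function.update_of_ne (by omega), hidx]
            have r3 : ∀ l' > d + 2, σ₃.row l' = σ'.row l' := fun l' hl' => by
              rw [h₃.row_above l' hl', grow l' hl']
            refine Exec.solveLoop_step h₃.reg2 (Exec.ite (1 + 50 * (i + 2) + 1) 1 (fun _ =>
              Exec.ite 1 (50 * (i + 2)) (fun hlt => ?_) (fun _ =>
              Exec.lift h₃.reg1 (by omega) i3 ?_ (fun j hj => ?_)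
                (fun σ₄ e0 e1 e2 ef ei er ew => ?_))) (fun hge => absurd ?_ hge))
            · simp only [BX.ev, IX.ev, h₃.reg1] at hlt
              omega
            · rw [r3 (d + 2 + 1) (by omega)]; exact hnz
            · have := h₃.pos j hj
              rw [hproj j hj, ← hcons, ← hcons] at this
              rw [r3 (d + 2 + 1) (by omega)]
              exact this
            · refine ihk (i + 1) σ₄ (by omega) ⟨?_, e1, e2.trans h₃.reg2, ?_, by simp [ei],
                fun l' hl' => ?_, fun l' hl' => funext fun j => ?_, fun j => ?_, fun j hj => ?_⟩
              · rw [e0, h₃.reg0, g0, h.reg0]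
              · rw [ef, h₃.flag, gf, h.flag]
              · rw [ei, Function.update_of_ne (by omega), h₃.idx_above _ (by omega), gi,
                  Function.update_of_ne (by omega), h.idx_above l' hl']
              · rw [er l' j (by omega) (Or.inl (by omega)), r3 _ (by omega), h.row_above l' hl']
              · rw [er _ _ (by omega) (Or.inr (by omega)), r3 _ (by omega), hcons]
              · have := ew j hj
                rw [r3 (d + 2 + 1) (by omega)] at this
                rw [← hcons]
                exact this
            · simp [BX.ev, IX.ev, h₃.reg1, h₃.idx, i3]
    have := main m 0 σ (by omega) h0
    rw [← Finset.range_eq_Ico] at this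
    exact this

end RealRAM

/-! ### Time bound for the solver, and the search for the minimal vertices -/

namespace RealRAM

open StrictSystem

variable {E : Env}

/-- The factor two compensates for the two terms in the recursion of `solveTime`, so that the
constant does not grow with the dimension. -/
theorem two_mul_sum_pow_le (k m : ℕ) :
    2 * ∑ j ∈ Finset.range m, (j + 1) ^ (k + 1) ≤ (m + 1) ^ (k + 2) := by
  induction m with
  | zero => simp
  | succ m ih =>
    rw [Finset.sum_range_succ, mul_add]
    have h1 : (m + 1) ^ (k + 2) + 2 * (m + 1) ^ (k + 1) = (m + 1) ^ k * ((m + 1) * (m + 3)) := by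
      ring
    have h2 : (m + 1) ^ k * ((m + 1) * (m + 3)) ≤ (m + 2) ^ k * ((m + 2) * (m + 2)) :=
      Nat.mul_le_mul (Nat.pow_le_pow_left (by omega) _) (by nlinarith)
    have h3 : (m + 2) ^ k * ((m + 2) * (m + 2)) = (m + 1 + 1) ^ (k + 2) := by ring
    omega

/-- In the induction step the recursive calls contribute at most `200` and the other work at most
`100` times the power. -/
theorem solveTime_le (d : ℕ) : ∀ m, solveTime d m ≤ 400 * (m + 1) ^ (d + 1) := by
  induction d with
  | zero => intro m; simp only [solveTime, zero_add, pow_one]; omega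
  | succ d ih =>
    intro m
    have h1 := two_mul_sum_pow_le d m
    have h2 := two_mul_sum_pow_le 0 m
    have h3 : (m + 1) ^ (0 + 2) ≤ (m + 1) ^ (d + 2) := Nat.pow_le_pow_right (by omega) (by omega)
    have h4 : solveTime (d + 1) m ≤
        ∑ j ∈ Finset.range m, (400 * (j + 1) ^ (d + 1) + 200 * (j + 1) ^ (0 + 1)) :=
      Finset.sum_le_sum fun j _ => by have := ih j; simp only [zero_add, pow_one]; omega
    rw [Finset.sum_add_distrib, ← Finset.mul_sum, ← Finset.mul_sum] at h4
    have : d + 1 + 1 = d + 2 := rfl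
    rw [this]
    omega

/-! ### Finding the vertices -/

/-- The differences of the input points different from the point `p` to the point `p`. -/
def Env.diffs (E : Env) (p j : ℕ) : Fin E.D → ℝ :=
  E.point (if j < p then j else j + 1) - E.point p

/-- Clear the row `(l, i)`. -/
def clear (l i : IX) : Prog := .seq (setSc 0 (.k (-1))) (axpy l i l i 0 l i)

theorem Exec.clear {l i : IX} {σ : St E} {Q : St E → Prop}
    (h : ∀ f, Q ({ σ with sc := f }.setRow (l.ev σ) (i.ev σ) 0))
    (hc : l.comp.cost + l.comp.cost + l.comp.cost + i.comp.cost + i.comp.cost +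
      i.comp.cost ≤ 200 := by decide) :
    Exec (RealRAM.clear l i) σ 2 Q := by
  refine Exec.cons (Exec.setSc (Exec.axpy (hc := hc) (v := 0) ?_ ?_))
  · simp [St.setSc, RX.ev]
  · simp only [IX.ev_setSc]
    exact h _

/-- Write the system that decides whether the point `reg 0` is a vertex to the level `D`. -/
def buildSystem : Prog :=
  forReg 4 (.sub .N (.k 1)) (.seq (clear .D (.add (.reg 4) (.k 1)))
    (loadDiff .D (.add (.reg 4) (.k 1))
      (.add (.reg 4) (.sub (.k 1) (.sub (.reg 0) (.reg 4)))) (.reg 0)))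

/-- Decide whether the point `reg 0` is a vertex. -/
def vertexTest : Prog :=
  .seq buildSystem (.seq (setIdx (.add .D (.k 1)) (.sub .N (.k 1))) (.seq (setIdx .D (.k 0))
    (.seq (setReg 1 .D) (.seq (setReg 2 (.k 1)) (.seq solveLoop
      (setFlag (.reg 0) (.reg 2)))))))

theorem Exec.buildSystem {σ : St E} {p : ℕ} {Q : St E → Prop} (hn : E.n ≤ E.D)
    (hp : σ.reg 0 = p) (hpN : p < E.N)
    (h : ∀ σ' : St E, σ'.reg 0 = p → σ'.flag = σ.flag →
      (∀ j < E.N - 1, σ'.row E.D (j + 1) = E.diffs p j) → Q σ') :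
    Exec RealRAM.buildSystem σ (4 * E.N) Q := by
  refine Exec.mono (q := (E.N - 1) * (3 + 1) + 1) (Exec.forReg (m := E.N - 1) (q := 3)
    (fun k σ' => σ'.reg 0 = p ∧ σ'.flag = σ.flag ∧
      ∀ j < k, σ'.row E.D (j + 1) = E.diffs p j)
    (hm := fun k σ' _ _ => rfl) (h0 := ⟨hp, rfl, by simp⟩) (hc := ?_)
    (hQ := fun σ' ⟨h0, hf, hr⟩ => h _ (by simpa [St.setReg] using h0) hf hr)) (by omega)
    (fun _ h => h)
  rintro k σ' hk ⟨h0, hf, hr⟩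
  -- Truncated subtraction skips the index `p` without a test.
  have hq : k + (1 - (p - k)) = if k < p then k else k + 1 := by split <;> omega
  refine Exec.seq (q := 2) (r := 1) (Exec.clear fun f => Exec.loadDiff hn ?_ ?_ ?_ ?_)
  · simp [IX.ev, St.setReg, St.setRow, h0]
    omega
  · simpa [IX.ev, St.setReg, St.setRow, h0] using hpN
  · simp [IX.ev, St.setReg, St.setRow]
  · refine ⟨by simp [St.setReg, St.setRow], by simpa [St.setReg, St.setRow] using h0, hf,
      fun j hj => ?_⟩
    rcases Nat.lt_succ_iff_lt_or_eq.1 hj with hj | rfl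
    · simpa [St.setReg, St.setRow, IX.ev, show ¬ j = k by omega] using hr j hj
    · simp [St.setReg, St.setRow, IX.ev, h0, hq, Env.diffs]

theorem Exec.vertexTest {σ : St E} {p : ℕ} {Q : St E → Prop} (hn : E.n ≤ E.D) (hD : 2 ≤ E.D)
    (hp : σ.reg 0 = p) (hpN : p < E.N)
    (h : ∀ σ' : St E, σ'.reg 0 = p → (∀ q ≠ p, σ'.flag q = σ.flag q) →
      (σ'.flag p ≠ 0 ↔ Feas (E.diffs p) (E.N - 1)) → Q σ') :
    Exec RealRAM.vertexTest σ (solveTime (E.D - 2) (E.N - 1) + 20 * E.N) Q := by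
  refine Exec.mono (q := 4 * E.N + ((solveTime (E.D - 2) (E.N - 1) + 5) + 1 + 1 + 1 + 1 + 1))
    (Exec.seq (Exec.buildSystem hn hp hpN fun σ' h0 hf hr => Exec.cons (Exec.setIdx
    (Exec.cons (Exec.setIdx (Exec.cons (Exec.setReg (Exec.cons (Exec.setReg
    (Exec.seq (q := solveTime (E.D - 2) (E.N - 1) + 5) (r := 1) ?_))))))))))
    (by omega) (fun _ h => h)
  obtain ⟨d, hd⟩ : ∃ d, d + 2 = E.D := ⟨E.D - 2, by omega⟩
  set τ : St E := St.setReg (St.setReg (St.setIdx (St.setIdx _ _ _) _ _) _ _) _ _ with hτ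
  have e0 : τ.reg 0 = p := by simpa [hτ, St.setReg, St.setIdx] using h0
  have e1 : τ.reg 1 = d + 2 := by simp [hτ, St.setReg, St.setIdx, IX.ev, hd]
  have e2 : τ.reg 2 = 1 := by simp [hτ, St.setReg, St.setIdx, IX.ev]
  have ef : τ.flag = σ.flag := hf
  have ei : τ.idx (d + 2) = 0 := by simp [hτ, St.setReg, St.setIdx, IX.ev, hd]
  have em : τ.idx (d + 3) = E.N - 1 := by
    have : d + 3 = E.D + 1 := by omega
    simp [hτ, St.setReg, St.setIdx, IX.ev, this]
  have er : ∀ j < E.N - 1, τ.row (d + 2) (j + 1) = E.diffs p j := by rw [hd]; exact hr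
  clear_value τ
  have hfeas : Feas (fun j => τ.row (d + 2) (j + 1)) (E.N - 1) ↔ Feas (E.diffs p) (E.N - 1) :=
    exists_congr fun w => forall_congr' fun j => forall_congr' fun hj => by
      simp only [er j hj]
  -- When the register `2` is no longer `1` the loop stops, and its value becomes the flag: zero
  -- exactly for unsolvable systems.
  have fin : ∀ σ'' : St E, σ''.reg 0 = p → σ''.flag = σ.flag → σ''.reg 2 ≠ 1 →
      (σ''.reg 2 ≠ 0 ↔ Feas (E.diffs p) (E.N - 1)) →
      Exec solveLoop σ'' 1 (fun σ' => Exec (RealRAM.setFlag (.reg 0) (.reg 2)) σ' 1 Q) := by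
    intro σ'' k0 kf k2 kF
    refine Exec.loop_false (fun hb => k2 ?_) (Exec.setFlag (h _ ?_ (fun q hq => ?_) ?_))
    · simp only [BX.ev, IX.ev] at hb
      omega
    · simpa [St.setFlag] using k0
    · simp [St.setFlag, IX.ev, k0, hq, kf]
    · simpa [St.setFlag, IX.ev, k0] using kF
  have hd' : E.D - 2 = d := by omega
  rw [hd']
  refine solve d τ (E.N - 1) ⊤ 5 _ hd.le (by simp [hd]) em (fun _ _ => Submodule.mem_top)
    ⟨rfl, e1, e2, rfl, ei, fun _ _ => rfl, fun _ _ => rfl, fun _ => rfl, by simp⟩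
    (fun σ'' k0 k2 kf hno => ?_) (fun σ'' ht => ?_)
  · exact (fin σ'' (k0.trans e0) (kf.trans ef) (by omega)
      (by rw [← hfeas]; simp [k2, hno])).mono (by omega) (fun _ h => h)
  · have hF : Feas (E.diffs p) (E.N - 1) := hfeas.1 ⟨_, ht.pos⟩
    have hidx : σ''.idx (d + 3) = E.N - 1 := by rw [ht.idx_above _ (by omega), em]
    refine Exec.solveLoop_step (q := 3) (r := 1) ht.reg2 (Exec.ite 2 0 (fun _ =>
      Exec.ite 1 0 (fun _ => Exec.setReg ?_) (fun hb => absurd ?_ hb)) (fun hb => absurd ?_ hb))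
    · refine fin _ ?_ (ht.flag.trans ef) (by simp [St.setReg, IX.ev])
        (by simp [St.setReg, IX.ev, hF])
      simpa [St.setReg] using ht.reg0.trans e0
    · simp [BX.ev, IX.ev, ht.reg1, hd]
    · simp [BX.ev, IX.ev, ht.reg1, ht.idx, hidx]

/-- Decide for all points whether they are vertices. -/
def findVertices : Prog := forReg 0 .N vertexTest

theorem Exec.findVertices {σ : St E} {Q : St E → Prop} (hn : E.n ≤ E.D) (hD : 2 ≤ E.D)
    (h : ∀ σ' : St E, (∀ p < E.N, σ'.flag p ≠ 0 ↔ Feas (E.diffs p) (E.N - 1)) → Q σ') :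
    Exec RealRAM.findVertices σ
      (E.N * (solveTime (E.D - 2) (E.N - 1) + 20 * E.N + 1) + 1) Q := by
  refine Exec.forReg (m := E.N)
    (fun k σ' => ∀ p < k, σ'.flag p ≠ 0 ↔ Feas (E.diffs p) (E.N - 1))
    (hm := fun k σ' _ _ => rfl) (h0 := by simp) (hc := fun k σ' hk hI => ?_)
    (hQ := fun σ' hI => h _ hI)
  refine Exec.vertexTest hn hD (by simp [St.setReg]) hk fun σ'' k0 kf kF => ⟨k0, fun p hp => ?_⟩
  rcases Nat.lt_succ_iff_lt_or_eq.1 hp with hp | rfl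
  · rw [kf p (by omega)]
    exact hI p hp
  · exact kF

/-! ### Finding the minimal vertices -/

/-- Clear the register `3` if the point `reg 4` is a vertex below the point `reg 0`. -/
def compareBody : Prog :=
  .ite (BX.and (.ile (.k 1) (.flag (.reg 4)))
      (.not (.and (.ile (.reg 4) (.reg 0)) (.ile (.reg 0) (.reg 4))))).comp
    (.seq (clear (.k 0) (.k 0)) (.seq (loadDiff (.k 0) (.k 0) (.reg 0) (.reg 4))
      (.seq (allNonneg 5 (.k 0) (.k 0))
        (.ite (BX.ile (.k 1) (.reg 5)).comp (setReg 3 (.k 0)) .skip)))) .skip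

/-- Mark the minimal vertices in the first integer array. -/
def findMinimal : Prog :=
  forReg 0 .N (.seq (setReg 3 (.flag (.reg 0))) (.seq (forReg 4 .N compareBody)
    (setIdx (.reg 0) (.reg 3))))

/-- Among the points that satisfy `V`, the point `p` is minimal. -/
def Env.IsMin (E : Env) (V : ℕ → Prop) (p : ℕ) : Prop :=
  V p ∧ ∀ q < E.N, V q → q ≠ p → ¬ 0 ≤ E.point p - E.point q

theorem Exec.compareBody {σ : St E} {p q : ℕ} {Q : St E → Prop} (hn : E.n ≤ E.D)
    (hp : σ.reg 0 = p) (hq : σ.reg 4 = q) (hpN : p < E.N) (hqN : q < E.N)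
    (h : ∀ σ' : St E, σ'.reg 0 = p → σ'.reg 4 = q → σ'.flag = σ.flag → σ'.idx = σ.idx →
      (σ'.reg 3 ≠ 0 ↔ σ.reg 3 ≠ 0 ∧ (σ.flag q ≠ 0 → q ≠ p → ¬ 0 ≤ E.point p - E.point q)) →
      Q σ') : Exec RealRAM.compareBody σ 9 Q := by
  refine Exec.ite 7 1 (fun hb => ?_) (fun hb => ?_)
  · simp only [BX.ev, IX.ev, hp, hq] at hb
    have h1 : σ.flag q ≠ 0 := by omega
    have h2 : q ≠ p := by omega
    refine Exec.seq (q := 2) (r := 5) (Exec.clear fun f => Exec.cons (Exec.loadDiff hn ?_ ?_ ?_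
      (Exec.cons (Exec.allNonneg (Exec.ite 1 1 (fun hb' => ?_) (fun hb' => ?_))))))
    · simpa [IX.ev, St.setRow, hp] using hpN
    · simpa [IX.ev, St.setRow, hq] using hqN
    · simp [IX.ev, St.setRow]
    · have h0 : 0 ≤ E.point p - E.point q := by
        by_contra h0
        simp only [BX.ev, IX.ev, St.setReg, St.setRow, Function.update_self, hp, hq, h0,
          if_false] at hb'
        omega
      refine Exec.setReg (h _ ?_ ?_ rfl rfl ?_)
      · simpa [St.setReg, St.setRow] using hp
      · simpa [St.setReg, St.setRow] using hq
      · simp only [St.setReg, St.setRow, IX.ev, Function.update_self]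
        tauto
    · have h0 : ¬ 0 ≤ E.point p - E.point q := by
        intro h0
        simp only [BX.ev, IX.ev, St.setReg, St.setRow, Function.update_self, hp, hq, h0,
          if_true] at hb'
        omega
      refine Exec.skip (h _ ?_ ?_ rfl rfl ?_)
      · simpa [St.setReg, St.setRow] using hp
      · simpa [St.setReg, St.setRow] using hq
      · simp only [St.setReg, St.setRow, Function.update_of_ne (show (3 : ℕ) ≠ 5 by decide)]
        tauto
  · simp only [BX.ev, IX.ev, hp, hq] at hb
    refine Exec.skip (h σ hp hq rfl rfl ?_)
    have : σ.flag q ≠ 0 → q = p := by omega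
    tauto

theorem Exec.findMinimal {σ : St E} {Q : St E → Prop} (hn : E.n ≤ E.D)
    (h : ∀ σ' : St E, (∀ p < E.N, σ'.idx p ≠ 0 ↔ E.IsMin (fun q => σ.flag q ≠ 0) p) → Q σ') :
    Exec RealRAM.findMinimal σ (E.N * (10 * E.N + 4) + 1) Q := by
  refine Exec.mono (q := E.N * ((E.N * (9 + 1) + 1 + 1) + 1 + 1) + 1) (Exec.forReg (m := E.N)
    (q := (E.N * (9 + 1) + 1 + 1) + 1)
    (fun k σ' => σ'.flag = σ.flag ∧
      ∀ p < k, σ'.idx p ≠ 0 ↔ E.IsMin (fun q => σ.flag q ≠ 0) p)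
    (hm := fun k σ' _ _ => rfl) (h0 := ⟨rfl, by simp⟩) (hc := ?_)
    (hQ := fun σ' hI => h _ hI.2)) (by
      have : E.N * (9 + 1) + 1 + 1 + 1 + 1 = 10 * E.N + 4 := by omega
      rw [this]) (fun _ h => h)
  rintro p σ' hp ⟨hf, hI⟩
  refine Exec.cons (Exec.setReg (Exec.seq (q := E.N * (9 + 1) + 1) (r := 1) ?_))
  refine Exec.forReg (σ := St.setReg (St.setReg σ' 0 p) 3 _) (e := .N) (m := E.N) (q := 9)
    (fun k σ'' => σ''.reg 0 = p ∧ σ''.flag = σ.flag ∧ σ''.idx = σ'.idx ∧ (σ''.reg 3 ≠ 0 ↔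
      -- The register `3` starts as the flag of `p`, so points that are not vertices are never
      -- marked.
      σ.flag p ≠ 0 ∧ ∀ q < k, σ.flag q ≠ 0 → q ≠ p → ¬ 0 ≤ E.point p - E.point q))
    (hm := fun k σ' _ _ => rfl) (h0 := ⟨?_, hf, rfl, ?_⟩) (hc := ?_) (hQ := ?_)
  · simp [St.setReg]
  · simp [St.setReg, IX.ev, hf]
  · rintro q σ'' hq ⟨k0, kf, ki, k3⟩
    refine Exec.compareBody hn (p := p) (q := q) ?_ (by simp [St.setReg]) hp hq
      fun σ₃ g0 g4 gf gi g3 => ⟨g4, g0, gf.trans kf, gi.trans ki, ?_⟩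
    · simpa [St.setReg] using k0
    · rw [g3, Nat.forall_lt_succ_right, ← and_assoc, ← k3]
      simp [St.setReg, kf]
  · rintro σ'' ⟨k0, kf, ki, k3⟩
    refine Exec.setIdx ⟨?_, kf, fun q hq => ?_⟩
    · simpa [St.setReg, St.setIdx] using k0
    · rcases Nat.lt_succ_iff_lt_or_eq.1 hq with hq | rfl
      · simpa [St.setReg, St.setIdx, IX.ev, k0, ki, show ¬ q = p by omega] using hI q hq
      · simpa [St.setReg, St.setIdx, IX.ev, k0, Env.IsMin] using k3

end RealRAM

namespace RealRAM

open StrictSystem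

variable {E : Env}

/-! ### Writing the output -/

/-- The address of the term whose number is in the integer cell `c`. -/
def termAddr (c : ℕ) : IExpr := .mul (.load (.const c)) (.add (.load (.const 0)) (.const 1))

/-- Copy the exponents of the term number `int 5` to those of the term number `int 4`. -/
def copyTerm : Prog :=
  forLoop 7 (.load (.const 0))
    (.rstore (.add (.add (termAddr 4) (.const 1)) (.load (.const 7)))
      (.load (.add (.add (termAddr 5) (.const 1)) (.load (.const 7)))))

/-- Move the marked terms to the front, with coefficient `0`, and count them. -/
def compact : Prog :=
  .seq (.istore (.const 4) (.const 0)) (.seq (forLoop 5 (.load (.const 1))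
    (.ite (.ile (.const 1) (.load (.add (.const 9) (.mul (.const 3) (.load (.const 5))))))
      (.seq (.rstore (termAddr 4) (.const 0)) (.seq copyTerm
        (.istore (.const 4) (.add (.load (.const 4)) (.const 1))))) .skip))
    (.istore (.const 1) (.load (.const 4))))

/-- Since `c ≤ i`, the target never runs ahead of the source, and the exponents still to be copied
are intact. -/
theorem copyTerm_runs {n c i : ℕ} (hci : c ≤ i) (M : Mem) (hn : M.int 0 = n) (hc : M.int 4 = c)
    (hi : M.int 5 = i) :
    ∃ t M', Runs copyTerm M t M' ∧ t ≤ 60 * (n + 1) ∧ M'.int = Function.update M.int 7 n ∧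
      (∀ a, a ≤ c * (n + 1) ∨ (i + 1) * (n + 1) ≤ a → M'.real a = M.real a) ∧
      ∀ k < n, M'.real (c * (n + 1) + 1 + k) = M.real (i * (n + 1) + 1 + k) := by
  have hle : c * (n + 1) ≤ i * (n + 1) := Nat.mul_le_mul_right _ hci
  obtain ⟨t, M', h1, h2, h3, -, h4, h5⟩ := runs_forLoop 7 (.load (.const 0))
    (.rstore (.add (.add (termAddr 4) (.const 1)) (.load (.const 7)))
      (.load (.add (.add (termAddr 5) (.const 1)) (.load (.const 7))))) n 30
    (fun k M' => M'.int = Function.update M.int 7 k ∧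
      (∀ a, i * (n + 1) + 1 + k ≤ a → M'.real a = M.real a) ∧
      (∀ a, a ≤ c * (n + 1) ∨ (i + 1) * (n + 1) ≤ a → M'.real a = M.real a) ∧
      ((∀ j < k, M'.real (c * (n + 1) + 1 + j) = M.real (i * (n + 1) + 1 + j))))
    (by
      rintro k M' ⟨h, -⟩
      exact ⟨by simp [h], by simp [IExpr.eval, h, hn]⟩)
    (by
      rintro k M' hk ⟨h, hhi, hout, hj⟩
      have e0 : M'.int 0 = n := by simp [h, hn]
      have e4 : M'.int 4 = c := by simp [h, hc]
      have e5 : M'.int 5 = i := by simp [h, hi]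
      have e7 : M'.int 7 = k := by simp [h]
      have hi1 : (i + 1) * (n + 1) = i * (n + 1) + (n + 1) := by ring
      refine ⟨_, _, Runs.rstore _ _ _, by simp [IExpr.cost, RExpr.cost, termAddr], e7, ?_⟩
      simp only [Mem.setReal, Mem.setInt, IExpr.eval, RExpr.eval, termAddr, e0, e4, e5, e7]
      refine ⟨by rw [h, Function.update_idem], fun a ha => ?_, fun a ha => ?_, fun j hj' => ?_⟩
      · rw [Function.update_of_ne (by omega)]
        exact hhi a (by omega)
      · rw [Function.update_of_ne (by omega)]
        exact hout a ha
      · rcases Nat.lt_succ_iff_lt_or_eq.1 hj' with hj' | rfl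
        · rw [Function.update_of_ne (by omega)]
          exact hj j hj'
        · rw [Function.update_self]
          exact hhi _ le_rfl)
    M ⟨rfl, fun _ _ => rfl, fun _ _ => rfl, by simp⟩
  refine ⟨t, M', h1, ?_, h3, h4, h5⟩
  simp only [IExpr.cost] at h2
  omega

theorem compact_runs {M : Mem} {σ : St E} (hM : Rep E M σ) :
    ∃ t M', Runs compact M t M' ∧ t ≤ 200 * ((E.N + 1) * (E.n + 1)) ∧ M'.int 0 = E.n ∧
      M'.int 1 = Nat.count (fun i => σ.idx i ≠ 0) E.N ∧
      ∀ j < M'.int 1, M'.real (j * (E.n + 1)) = 0 ∧ ∀ k < E.n, M'.real (j * (E.n + 1) + 1 + k) =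
        E.inp (Nat.nth (fun i => σ.idx i ≠ 0) j * (E.n + 1) + 1 + k) := by
  set K : ℕ → Prop := fun i => σ.idx i ≠ 0 with hK
  obtain ⟨t, M', h1, h2, h3⟩ := runs_forLoop 5 (.load (.const 1))
    (.ite (.ile (.const 1) (.load (.add (.const 9) (.mul (.const 3) (.load (.const 5))))))
      (.seq (.rstore (termAddr 4) (.const 0)) (.seq copyTerm
        (.istore (.const 4) (.add (.load (.const 4)) (.const 1))))) .skip) E.N (100 * (E.n + 1))
    (fun i M' => M'.int 0 = E.n ∧ M'.int 1 = E.N ∧ M'.int 4 = Nat.count K i ∧ M'.int 5 = i ∧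
      (∀ l, M'.int (9 + 3 * l) = σ.idx l) ∧
      -- The output is written over the input. At most `i` terms have been kept among the first `i`,
      -- so the unread part is unchanged.
      (∀ a, i * (E.n + 1) ≤ a → a < E.base → M'.real a = E.inp a) ∧
      ∀ j < Nat.count K i, M'.real (j * (E.n + 1)) = 0 ∧
        ∀ k < E.n, M'.real (j * (E.n + 1) + 1 + k) = E.inp (Nat.nth K j * (E.n + 1) + 1 + k))
    (fun i M' h => ⟨h.2.2.2.1, by simp [IExpr.eval, h.2.1]⟩)
    (by
      rintro i M' hi ⟨e0, e1, e4, e5, el, er, eo⟩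
      have hci : Nat.count K i ≤ i := Nat.count_le _
      have hle : Nat.count K i * (E.n + 1) ≤ i * (E.n + 1) := Nat.mul_le_mul_right _ hci
      have hi1 : (i + 1) * (E.n + 1) = i * (E.n + 1) + (E.n + 1) := by ring
      have hb : (Test.ile (.const 1) (.load (.add (.const 9)
          (.mul (.const 3) (.load (.const 5)))))).Holds M' ↔ K i := by
        simp only [Test.Holds, IExpr.eval, e5, el, hK]
        omega
      by_cases hKi : K i
      · obtain ⟨t, M₂, r, ht, g1, g2, g3⟩ := copyTerm_runs hci
          (M'.setReal (Nat.count K i * (E.n + 1)) 0) e0 e4 e5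
        have r1 := Runs.rstore (termAddr 4) (.const 0) M'
        simp only [termAddr, IExpr.eval, RExpr.eval, e0, e4, Int.cast_zero] at r1
        refine ⟨_, _, Runs.ite_true (hb.2 hKi) (Runs.seq r1 (Runs.seq r (Runs.istore _ _ _))),
          ?_, ?_, ?_⟩
        · simp only [Test.cost, IExpr.cost, RExpr.cost]
          omega
        · simp [Mem.setInt, Mem.setReal, IExpr.eval, g1, e5]
        · have hcount : Nat.count K (i + 1) = Nat.count K i + 1 := by
            rw [Nat.count_succ, if_pos hKi]
          simp only [Mem.setInt, IExpr.eval, g1, hcount]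
          refine ⟨by simp [Mem.setReal, e0], by simp [Mem.setReal, e1], by simp [Mem.setReal, e4],
            by simp, fun l => ?_, fun a ha hab => ?_, fun j hj => ?_⟩
          · rw [Function.update_of_ne (by omega), Function.update_of_ne (by omega),
              Function.update_of_ne (by omega)]
            exact el l
          · rw [g2 a (Or.inr ha)]
            simp only [Mem.setReal]
            rw [Function.update_of_ne (by omega)]
            exact er a (by omega) hab
          · rcases Nat.lt_succ_iff_lt_or_eq.1 hj with hj | rfl
            · have hj1 : (j + 1) * (E.n + 1) ≤ Nat.count K i * (E.n + 1) :=
                Nat.mul_le_mul_right _ hj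
              have hj2 : (j + 1) * (E.n + 1) = j * (E.n + 1) + (E.n + 1) := by ring
              refine ⟨?_, fun k hk => ?_⟩
              · rw [g2 _ (Or.inl (by omega))]
                simp only [Mem.setReal]
                rw [Function.update_of_ne (by omega)]
                exact (eo j hj).1
              · rw [g2 _ (Or.inl (by omega))]
                simp only [Mem.setReal]
                rw [Function.update_of_ne (by omega)]
                exact (eo j hj).2 k hk
            · refine ⟨?_, fun k hk => ?_⟩
              · rw [g2 _ (Or.inl le_rfl)]
                simp [Mem.setReal]
              · rw [g3 k hk, Nat.nth_count hKi]
                simp only [Mem.setReal]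
                rw [Function.update_of_ne (by omega)]
                exact er _ (by omega) (Env.lt_base hi hk)
      · refine ⟨_, _, Runs.ite_false (mt hb.1 hKi) (Runs.skip _), ?_, e5, ?_⟩
        · simp only [Test.cost, IExpr.cost]
          omega
        · have hcount : Nat.count K (i + 1) = Nat.count K i := by
            rw [Nat.count_succ, if_neg hKi, add_zero]
          rw [hcount]
          simp only [Mem.setInt]
          refine ⟨by simp [e0], by simp [e1], by simp [e4], by simp, fun l => ?_,
            fun a ha hab => er a (by omega) hab, eo⟩
          rw [Function.update_of_ne (by omega)]
          exact el l)
    (M.setInt 4 0) ⟨by simp [Mem.setInt, hM.n], by simp [Mem.setInt, hM.N],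
      by simp [Mem.setInt], by simp [Mem.setInt],
      fun l => by simpa [Mem.setInt, show ¬ 9 + 3 * l = 4 by omega,
        show ¬ 9 + 3 * l = 5 by omega] using hM.idx l,
      fun a _ ha => hM.inp a ha, by simp⟩
  obtain ⟨e0, e1, e4, e5, el, er, eo⟩ := h3
  have r0 := Runs.istore (.const 4) (.const 0) M
  simp only [IExpr.eval] at r0
  refine ⟨_, _, Runs.seq r0 (Runs.seq h1 (Runs.istore _ _ _)), ?_, ?_, ?_, ?_⟩
  · simp only [IExpr.cost] at h2 ⊢
    have h3 : (E.N + 1) * (E.n + 1) = E.N * (E.n + 1) + (E.n + 1) := by ring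
    have h4 : E.N * (100 * (E.n + 1) + (1 + 1) + 20) ≤ E.N * (150 * (E.n + 1)) :=
      Nat.mul_le_mul_left _ (by omega)
    have h5 : E.N * (150 * (E.n + 1)) = 150 * (E.N * (E.n + 1)) := by ring
    omega
  · simp [Mem.setInt, IExpr.eval, e0]
  · simp [Mem.setInt, IExpr.eval, e4]
    rfl
  · simpa [Mem.setInt, IExpr.eval, e4] using eo

/-! ### The program -/

/-- The program that computes `sMin`. -/
def minProg : Prog :=
  .seq (.istore (.const 2) (.mul (.load (.const 1)) (.add (.load (.const 0)) (.const 1))))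
  (.seq (.istore (.const 3) (.add (.load (.const 0)) (.sub (.const 2) (.load (.const 0)))))
  (.seq findVertices (.seq findMinimal compact)))

open Classical in
theorem minProg_runs {n N : ℕ} (hn : 1 ≤ n) (hN : 1 ≤ N) (M : Mem) (h0 : M.int 0 = n)
    (h1 : M.int 1 = N) {E : Env} (hE : E = ⟨n, N, n + (2 - n), M.real⟩) :
    ∃ t M', Runs minProg M t M' ∧ t ≤ 4000000 * (n * N ^ max 2 n) ∧ M'.int 0 = n ∧
      M'.int 1 = ((Finset.range N).filter
        (E.IsMin fun q => Feas (E.diffs q) (N - 1))).card ∧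
      ∃ f : ℕ → ℕ, (∀ j < M'.int 1, f j < N ∧ E.IsMin (fun q => Feas (E.diffs q) (N - 1)) (f j)) ∧
      Set.InjOn f {j | j < M'.int 1} ∧
      ∀ j < M'.int 1, M'.real (j * (n + 1)) = 0 ∧
        ∀ k < n, M'.real (j * (n + 1) + 1 + k) = M.real (f j * (n + 1) + 1 + k) := by
  have r1 := Runs.istore (.const 2) (.mul (.load (.const 1)) (.add (.load (.const 0)) (.const 1))) M
  simp only [IExpr.eval, h0, h1] at r1
  have r2 := Runs.istore (.const 3) (.add (.load (.const 0)) (.sub (.const 2) (.load (.const 0))))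
    (M.setInt 2 (N * (n + 1)))
  have h0' : (M.setInt 2 (N * (n + 1))).int 0 = n := by simp [Mem.setInt, h0]
  simp only [IExpr.eval, h0'] at r2
  set M₂ := (M.setInt 2 (N * (n + 1))).setInt 3 (n + (2 - n)) with hM₂
  have En : E.n = n := by rw [hE]
  have EN : E.N = N := by rw [hE]
  have ED : E.D = n + (2 - n) := by rw [hE]
  have Einp : E.inp = M.real := by rw [hE]
  have Eb : E.base = N * (n + 1) := by rw [hE]; rfl
  -- Arbitrary content of the other cells is a legitimate initial state; nothing needs to be
  -- initialised.
  let σ : St E := ⟨fun r => M.int (8 + 3 * r), fun l => M.int (9 + 3 * l),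
    fun p => M.int (10 + 3 * p), fun s => M.real (E.base + 2 * s),
    fun l i k => M.real (E.rowAddr l i + 2 * k)⟩
  have hrep : Rep E M₂ σ := by
    refine ⟨by simp [hM₂, Mem.setInt, h0, En], by simp [hM₂, Mem.setInt, h1, EN],
      by simp [hM₂, Mem.setInt, Eb], by simp [hM₂, Mem.setInt, ED], fun r => ?_, fun r => ?_,
      fun r => ?_, fun a _ => by rw [Einp]; rfl, fun s => rfl, fun l i k => rfl⟩
    · simp [hM₂, Mem.setInt, σ, show ¬ 8 + 3 * r = 2 by omega, show ¬ 8 + 3 * r = 3 by omega]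
    · simp [hM₂, Mem.setInt, σ, show ¬ 9 + 3 * r = 2 by omega, show ¬ 9 + 3 * r = 3 by omega]
    · simp [hM₂, Mem.setInt, σ, show ¬ 10 + 3 * r = 2 by omega, show ¬ 10 + 3 * r = 3 by omega]
  clear_value M₂ σ
  obtain ⟨t₁, M₃, σ₁, r3, ht3, hrep₁, hfl⟩ := Exec.findVertices (σ := σ)
    (Q := fun σ' => ∀ p < E.N, σ'.flag p ≠ 0 ↔ Feas (E.diffs p) (E.N - 1))
    (by omega) (by omega) (fun _ h => h) M₂ hrep
  obtain ⟨t₂, M₄, σ₂, r4, ht4, hrep₂, hidx⟩ := Exec.findMinimal (σ := σ₁)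
    (Q := fun σ' => ∀ p < E.N, σ'.idx p ≠ 0 ↔ E.IsMin (fun q => σ₁.flag q ≠ 0) p)
    (by omega) (fun _ h => h) M₃ hrep₁
  obtain ⟨t₃, M₅, r5, ht5, k0, k1, kr⟩ := compact_runs hrep₂
  have hmin : ∀ p < N, σ₂.idx p ≠ 0 ↔ E.IsMin (fun q => Feas (E.diffs q) (N - 1)) p := by
    intro p hp
    rw [hidx p (by omega), Env.IsMin, Env.IsMin, hfl p (by omega), EN]
    refine and_congr Iff.rfl (forall_congr' fun q => forall_congr' fun hq => ?_)
    rw [hfl q (by omega), EN]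
  rw [En, EN] at *
  have hcount := k1
  rw [Nat.count_eq_card_filter_range] at hcount
  refine ⟨_, M₅, Runs.seq r1 (Runs.seq r2 (Runs.seq r3 (Runs.seq r4 r5))), ?_, k0, ?_,
    Nat.nth (fun i => σ₂.idx i ≠ 0), fun j hj => ?_, fun j hj j' hj' hjj => ?_, ?_⟩
  · have hD : max 2 n = n + (2 - n) := by omega
    have hs := solveTime_le (E.D - 2) (N - 1)
    rw [show N - 1 + 1 = N by omega, show E.D - 2 + 1 = E.D - 1 by omega] at hs
    have hX : N ≤ N ^ (E.D - 1) := Nat.le_self_pow (by omega) N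
    have hY : N * N ^ (E.D - 1) = N ^ max 2 n := by
      rw [← pow_succ', hD, ← ED]
      congr 1
      omega
    set X := N ^ (E.D - 1)
    have hNX : N * N ≤ N * X := Nat.mul_le_mul_left _ hX
    have hNX' : N ≤ N * X := Nat.le_mul_of_pos_right _ (by omega)
    have hU1 : N * (solveTime (E.D - 2) (N - 1) + 20 * N + 1) + 1 ≤ 422 * (N * X) := by
      calc N * (solveTime (E.D - 2) (N - 1) + 20 * N + 1) + 1
          ≤ N * (421 * X) + 1 := by gcongr; omega
        _ = 421 * (N * X) + 1 := by ring
        _ ≤ _ := by omega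
    have hU2 : N * (10 * N + 4) + 1 ≤ 15 * (N * X) := by
      calc N * (10 * N + 4) + 1 ≤ N * (14 * X) + 1 := by gcongr; omega
        _ = 14 * (N * X) + 1 := by ring
        _ ≤ _ := by omega
    -- The unit is `1000 * (max 2 n + 1)`; equality holds for `n = 1`.
    have hu : E.unit ≤ 3000 * n := by unfold Env.unit; omega
    have ht3' := ht3.trans (Nat.mul_le_mul hU1 hu)
    have ht4' := ht4.trans (Nat.mul_le_mul hU2 hu)
    have hc : (N + 1) * (n + 1) ≤ (2 * N) * (2 * n) := Nat.mul_le_mul (by omega) (by omega)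
    have hc' : (2 * N) * (2 * n) = 4 * (n * N) := by ring
    have hc'' : n * N ≤ n * (N * X) := Nat.mul_le_mul_left _ hNX'
    have e1 : 422 * (N * X) * (3000 * n) = 1266000 * (n * (N * X)) := by ring
    have e2 : 15 * (N * X) * (3000 * n) = 45000 * (n * (N * X)) := by ring
    have e3 : 1 ≤ n * (N * X) := Nat.mul_pos (by omega) (by omega)
    rw [← hY]
    simp only [IExpr.cost]
    omega
  · rw [hcount]
    congr 1
    exact Finset.filter_congr fun p hp => hmin p (Finset.mem_range.1 hp)
  · rw [k1] at hj
    have hlt := Nat.nth_lt_of_lt_count hj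
    exact ⟨hlt, (hmin _ hlt).1 (Nat.nth_mem _ fun hf => hj.trans_le (Nat.count_le_card hf _))⟩
  · have hj1 : j < M₅.int 1 := hj
    have hj2 : j' < M₅.int 1 := hj'
    rw [k1] at hj1 hj2
    rw [← Nat.count_nth fun hf => hj1.trans_le (Nat.count_le_card hf _),
      ← Nat.count_nth fun hf => hj2.trans_le (Nat.count_le_card hf _), hjj]
  · rw [← Einp]
    exact kr

end RealRAM

/-! ### Correctness of the program on stored polynomials -/

namespace RealRAM

open StrictSystem TropPoly

variable {n : ℕ}

/-- The environment of the computation for a memory that holds a polynomial. -/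
abbrev inputEnv (n N : ℕ) (M : Mem) : Env := ⟨n, N, n + (2 - n), M.real⟩

theorem dot_append_zero {m : ℕ} (w : Fin (n + m) → ℝ) (v : Fin n → ℝ) :
    w ⬝ᵥ (Fin.append v 0 : Fin (n + m) → ℝ) = (fun i => w (Fin.castAdd m i)) ⬝ᵥ v := by
  simp [dotProduct, Fin.sum_univ_add]

theorem point_eq {s : MvPolynomial (Fin n) 𝕋} {M : Mem}
    (e : Fin s.support.card ≃ s.support)
    (he : ∀ (i : Fin s.support.card) (j : Fin n),
      M.real (i * (n + 1) + 1 + j) = ((e i : Fin n →₀ ℕ) j : ℝ))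
    (q : Fin s.support.card) :
    (inputEnv n s.support.card M).point q =
      (Fin.append (toPoint (e q : Fin n →₀ ℕ)) 0 : Fin (n + (2 - n)) → ℝ) := by
  funext k
  refine Fin.addCases (fun i => ?_) (fun i => ?_) k
  · rw [Fin.append_left]
    simp only [Env.point]
    rw [if_pos (by simp)]
    exact he q i
  · rw [Fin.append_right]
    simp [Env.point]

theorem point_sub {s : MvPolynomial (Fin n) 𝕋} {M : Mem}
    (e : Fin s.support.card ≃ s.support)
    (he : ∀ (i : Fin s.support.card) (j : Fin n),
      M.real (i * (n + 1) + 1 + j) = ((e i : Fin n →₀ ℕ) j : ℝ))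
    (q p : Fin s.support.card) :
    (inputEnv n s.support.card M).point q - (inputEnv n s.support.card M).point p =
      (Fin.append (toPoint (e q : Fin n →₀ ℕ) - toPoint (e p : Fin n →₀ ℕ)) 0 :
        Fin (n + (2 - n)) → ℝ) := by
  rw [point_eq e he, point_eq e he]
  funext k
  refine Fin.addCases (fun i => ?_) (fun i => ?_) k
  · simp only [Pi.sub_apply, Fin.append_left]
  · simp only [Pi.sub_apply, Fin.append_right, Pi.zero_apply, sub_zero]

/-- The padding coordinates of the differences vanish, so a solution may be restricted to the first
`n` coordinates or extended by zero. -/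
theorem feas_diffs_iff {s : MvPolynomial (Fin n) 𝕋} {M : Mem}
    (e : Fin s.support.card ≃ s.support)
    (he : ∀ (i : Fin s.support.card) (j : Fin n),
      M.real (i * (n + 1) + 1 + j) = ((e i : Fin n →₀ ℕ) j : ℝ))
    (p : Fin s.support.card) :
    Feas ((inputEnv n s.support.card M).diffs p) (s.support.card - 1) ↔
      (e p : Fin n →₀ ℕ) ∈ vertNP s := by
  rw [mem_vertNP_iff (e p).2]
  constructor
  · rintro ⟨w, hw⟩
    refine ⟨fun i => w (Fin.castAdd (2 - n) i), fun ν hν hne => ?_⟩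
    obtain ⟨q, hq⟩ := e.surjective ⟨ν, hν⟩
    have hqν : (e q : Fin n →₀ ℕ) = ν := by rw [hq]
    have hqp : (q : ℕ) ≠ p := fun h => hne (by rw [← hqν, Fin.ext h])
    -- The position of `q` in the enumeration that skips `p`.
    have h1 := hw (if (q : ℕ) < p then q else q - 1) (by split <;> omega)
    have h2 : (if (if (q : ℕ) < p then (q : ℕ) else q - 1) < p then
        (if (q : ℕ) < p then (q : ℕ) else q - 1)
        else (if (q : ℕ) < p then (q : ℕ) else q - 1) + 1) = q := by
      split_ifs <;> omega
    rw [Env.diffs, h2, point_sub e he, hqν, dot_append_zero] at h1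
    exact h1
  · rintro ⟨w, hw⟩
    refine ⟨(Fin.append w 0 : Fin (n + (2 - n)) → ℝ), fun j hj => ?_⟩
    have hlt : (if j < (p : ℕ) then j else j + 1) < s.support.card := by split <;> omega
    have hne : (if j < (p : ℕ) then j else j + 1) ≠ p := by split <;> omega
    have h1 := hw (e ⟨_, hlt⟩) (e ⟨_, hlt⟩).2 fun h =>
      hne (congrArg Fin.val (e.injective (Subtype.ext h)))
    have h2 := point_sub e he ⟨_, hlt⟩ p
    simp only at h2
    rw [Env.diffs, h2, dot_append_zero]
    simpa only [Fin.append_left] using h1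

theorem isMin_iff {s : MvPolynomial (Fin n) 𝕋} {M : Mem}
    (e : Fin s.support.card ≃ s.support)
    (he : ∀ (i : Fin s.support.card) (j : Fin n),
      M.real (i * (n + 1) + 1 + j) = ((e i : Fin n →₀ ℕ) j : ℝ))
    (p : Fin s.support.card) :
    (inputEnv n s.support.card M).IsMin (fun q =>
      Feas ((inputEnv n s.support.card M).diffs q) (s.support.card - 1)) p ↔
      (e p : Fin n →₀ ℕ) ∈ vertNPmin s := by
  have hle : ∀ q : Fin s.support.card, 0 ≤ (inputEnv n s.support.card M).point p -
      (inputEnv n s.support.card M).point q ↔ (e q : Fin n →₀ ℕ) ≤ e p := by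
    intro q
    rw [point_sub e he, Finsupp.le_def, Pi.le_def]
    constructor
    · intro h i
      have := h (Fin.castAdd (2 - n) i)
      rw [Fin.append_left] at this
      simp only [Pi.zero_apply, Pi.sub_apply, toPoint, sub_nonneg] at this
      exact_mod_cast this
    · intro h k
      refine Fin.addCases (fun i => ?_) (fun i => ?_) k
      · rw [Fin.append_left]
        simp only [Pi.zero_apply, Pi.sub_apply, toPoint, sub_nonneg]
        exact_mod_cast h i
      · rw [Fin.append_right]
        exact le_rfl
  constructor
  · rintro ⟨h1, h2⟩
    refine ⟨(feas_diffs_iff e he p).1 h1, fun ν hν hνp => ?_⟩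
    obtain ⟨q, hq⟩ := e.surjective ⟨ν, vertNP_subset s hν⟩
    have hqν : (e q : Fin n →₀ ℕ) = ν := by rw [hq]
    by_cases hqp : q = p
    · rw [← hqν, hqp]
    · refine absurd ((hle q).2 (by rw [hqν]; exact hνp)) (h2 q q.2 ?_ fun h => hqp (Fin.ext h))
      exact (feas_diffs_iff e he q).2 (by rw [hqν]; exact hν)
  · rintro ⟨h1, h2⟩
    refine ⟨(feas_diffs_iff e he p).2 h1, fun q hq hF hqp hle' => hqp ?_⟩
    have h3 := (hle ⟨q, hq⟩).1 hle'
    have h4 := h2 ((feas_diffs_iff e he ⟨q, hq⟩).1 hF) h3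
    -- The list has no repetition, so equal monomials have equal indices.
    exact congrArg Fin.val (e.injective (Subtype.ext (le_antisymm h3 h4)))

open Classical in
theorem minProg_correct (s : MvPolynomial (Fin n) 𝕋) (hn : 1 ≤ n) (hs : s ≠ 0) (M : Mem)
    (hM : Stores M s) : ∃ t M', Runs minProg M t M' ∧
      t ≤ 4000000 * (n * s.support.card ^ max 2 n) ∧ Stores M' (sMin s) := by
  obtain ⟨h0, h1, e, he⟩ := hM
  have he' := fun i j => (he i).2 j
  have hN : 1 ≤ s.support.card :=
    Finset.card_pos.2 (Finset.nonempty_iff_ne_empty.2 fun h => hs (MvPolynomial.support_eq_empty.1 h))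
  obtain ⟨t, M', hr, ht, k0, k1, f, hf, hinj, hout⟩ :=
    minProg_runs hn hN M h0 h1 (E := inputEnv n s.support.card M) rfl
  refine ⟨t, M', hr, ht, k0, ?_⟩
  -- The monomial at position `j` of the input; the default `0` is never used.
  let g : ℕ → Fin n →₀ ℕ := fun j => if h : j < s.support.card then e ⟨j, h⟩ else 0
  have hg : ∀ j (h : j < s.support.card), g j = e ⟨j, h⟩ := fun j h => dif_pos h
  have hginj : Set.InjOn g {j | j < s.support.card} := fun j hj j' hj' h => by
    rw [hg j hj, hg j' hj'] at h
    exact congrArg Fin.val (e.injective (Subtype.ext h))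
  obtain ⟨hsupp, hcoeff⟩ := support_sMin s
  have hmem : ∀ j (h : j < s.support.card), (inputEnv n s.support.card M).IsMin (fun q =>
      Feas ((inputEnv n s.support.card M).diffs q) (s.support.card - 1)) j ↔
      g j ∈ (sMin s).support := fun j h => by
    rw [hg j h, ← Finset.mem_coe, hsupp]
    exact isMin_iff e he' ⟨j, h⟩
  have hcard : (sMin s).support.card = M'.int 1 := by
    rw [k1, ← Finset.card_image_of_injOn (f := g)]
    · congr 1
      ext ν
      simp only [Finset.mem_image, Finset.mem_filter, Finset.mem_range]
      constructor
      · intro hν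
        have hν' : ν ∈ vertNPmin s := by rw [← hsupp]; exact hν
        obtain ⟨q, hq⟩ := e.surjective ⟨ν, vertNP_subset s hν'.prop⟩
        have hqν : g q = ν := by rw [hg q q.2, Fin.eta, hq]
        exact ⟨q, ⟨q.2, (hmem q q.2).2 (by rw [hqν]; exact hν)⟩, hqν⟩
      · rintro ⟨j, ⟨hj, hjm⟩, rfl⟩
        exact (hmem j hj).1 hjm
    · intro j hj j' hj' h
      simp only [Finset.coe_filter, Finset.mem_range] at hj hj'
      exact hginj hj.1 hj'.1 h
  let F : Fin (sMin s).support.card → (sMin s).support := fun j =>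
    ⟨g (f j), (hmem _ (hf j (hcard ▸ j.2)).1).1 (hf j (hcard ▸ j.2)).2⟩
  -- The output list has no repetition and the right length, hence it is complete.
  have hF : Function.Bijective F := by
    rw [Fintype.bijective_iff_injective_and_card]
    refine ⟨fun i j hij => ?_, by simp⟩
    have hi : (i : ℕ) < M'.int 1 := hcard ▸ i.2
    have hj : (j : ℕ) < M'.int 1 := hcard ▸ j.2
    exact Fin.ext (hinj hi hj (hginj (hf i hi).1 (hf j hj).1 (congrArg Subtype.val hij)))
  refine ⟨hcard.symm, Equiv.ofBijective F hF, fun i => ?_⟩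
  have hi : (i : ℕ) < M'.int 1 := hcard ▸ i.2
  refine ⟨?_, fun j => ?_⟩
  -- The coefficient written is the real number `0`, which is the tropical one.
  · rw [(hout i hi).1, hcoeff _ (Subtype.coe_prop _)]
    simp
  · rw [(hout i hi).2 j j.2]
    have := he' ⟨f i, (hf i hi).1⟩ j
    rw [this, ← hg (f i) (hf i hi).1]
    rfl

end RealRAM

theorem mainTheorem6 :
    ∃ (P : RealRAM.Prog) (C : ℕ),
      ∀ (n : ℕ) (s : MvPolynomial (Fin n) TropPoly.𝕋), 1 ≤ n → s ≠ 0 →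
        TropPoly.toPoint '' ((TropPoly.sMin s).support : Set (Fin n →₀ ℕ)) =
            Set.extremePoints ℝ (TropPoly.NPmin s) ∧
        ∀ M : RealRAM.Mem, RealRAM.Stores M s →
          RealRAM.haltProb P M {M' | RealRAM.Stores M' (TropPoly.sMin s)} = 1 ∧
          RealRAM.expectedTime P M ≤
            (C : ENNReal) * (n : ENNReal) * (s.support.card : ENNReal) ^ (max 2 n) := by
  refine ⟨RealRAM.minProg, 4000000, fun n s hn hs => ⟨TropPoly.image_support_sMin s,
    fun M hM => ?_⟩⟩
  obtain ⟨t, M', hr, ht, hM'⟩ := RealRAM.minProg_correct s hn hs M hM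
  refine ⟨hr.haltProb_eq hM', ?_⟩
  rw [hr.expectedTime_eq, mul_assoc]
  exact_mod_cast ht
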